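/- Let $n,l$ be natural numbers with $l\ge 2n$, and let $\rho_0:GL(n,\mathbf C)\to GL(V)$ be an irreducible polynomial representation on a finite-dimensional complex vector space $V$ (so all matrix coefficients of $\rho_0$ are polynomials in the matrix entries). Let $\langle\cdot,\cdot\rangle$ be a non-degenerate bilinear form on $V$ with $\langle v_1,\rho_0(g)v_2\rangle=\langle\rho_0(g^t)v_1,v_2\rangle$ for all $g\in GL(n,\mathbf C)$, and let $\bullet:V\otimes V\to\mathrm{End}(V)$ be the linear map with $(v_1\otimes v_2)^\bullet(v)=\langle v,v_1\rangle v_2$. Write $\mathbf H_m=\{Z\in \mathrm{Sym}_m(\mathbf C):\operatorname{Im}Z>0\}$. For $M=\begin{pmatrix}A&B\\C&D\end{pmatrix}\in Sp(m,\mathbf R)$ write $M\langle Z\rangle=(AZ+B)(CZ+D)^{-1}$, $(F|_sM)(Z)=\det(CZ+D)^{-s}F(M\langle Z\rangle)$ and $(f|_{\det^s\otimes\rho_0}M)(z)=\det(cz+d)^{-s}\rho_0(cz+d)^{-1}f(M\langle z\rangle)$ for $M=\begin{pmatrix}a&b\\c&d\end{pmatrix}\in Sp(n,\mathbf R)$.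 For a $V\otimes V$-valued polynomial $Q$ in the entries of a symmetric $2n\times 2n$ matrix of variables put $$(\Delta_QF)(z,w)=\bigl(Q((\partial_{ij}))F\bigr)\begin{pmatrix}z&0\\0&w\end{pmatrix},\qquad z,w\in\mathbf H_n,\qquad \partial_{ij}=\tfrac{1+\delta_{ij}}2\,\frac{\partial}{\partial z_{ij}} .$$ Let $Q_l$ be a nonzero polynomial of this kind for which $\Delta=\Delta_{Q_l}$ satisfies, with $s=l/2$, $$(\Delta F)\big|^z_{\det^s\otimes\rho_0}M_1\big|^w_{\det^s\otimes\rho_0}M_2=\Delta\bigl(F|_s M_1^\uparrow M_2^\downarrow\bigr)$$ for all $M_1,M_2\in Sp(n,\mathbf R)$ and all holomorphic $F:\mathbf H_{2n}\to\mathbf C$. Here $M_1^\uparrow M_2^\downarrow\in Sp(2n,\mathbf R)$ is the image of $(M_1,M_2)$ under the standard embedding $Sp(n,\mathbf R)\times Sp(n,\mathbf R)\hookrightarrow Sp(2n,\mathbf R)$, and the powers on both sides come from one holomorphic branch of $\det(CZ+D)^s$ on $\mathbf H_{2n}$, where $(C\ D)$ is the lower half of $M_1^\uparrow M_2^\downarrow$.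 The choice of branch is immaterial. For real $l\times n$ matrices $X,Y$ define $$\mathbf P_l(X,Y)=Q_l\begin{pmatrix}X^tX&X^tY\\Y^tX&Y^tY\end{pmatrix}\in V\otimes V .$$ Proposition 3.2. There is $X_0\in\mathbf R^{(l,n)}$, which may be chosen of maximal rank $n$, such that $\det\bigl(\mathbf P_l(X_0,X_0)^\bullet\bigr)\ne0$. Consequently $\det\Bigl(Q_l\begin{pmatrix}T&T\\T&T\end{pmatrix}^{\bullet}\Bigr)\ne 0$ for every positive definite $T\in\mathrm{Sym}_n(\mathbf R)$. -/

import Mathlib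

open scoped TensorProduct Matrix

noncomputable section

namespace SiegelDiff

/-! ### Symmetric matrices and the Siegel upper half space -/

/-- Complex symmetric matrices with rows and columns indexed by `σ`, given by their entries
`z_{ij} = z_{ji}`, one for each unordered pair of indices. -/
abbrev SymMat (σ : Type) : Type := Sym2 σ → ℂ

/-- The matrix with entries `z_{ij}`. -/
def SymMat.toMatrix {σ : Type} (Z : SymMat σ) : Matrix σ σ ℂ :=
  Matrix.of fun i j => Z s(i, j)

/-- The entries of a symmetric matrix. (Only ever applied to symmetric matrices `X`, for which
`(X i j + X j i) / 2 = X i j`.) -/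
def symOfMatrix {σ : Type} (X : Matrix σ σ ℂ) : SymMat σ :=
  Sym2.lift ⟨fun i j => (X i j + X j i) / 2, fun i j => congrArg (· / 2) (add_comm (X i j) (X j i))⟩

/-- The Siegel upper half space `{Z = Zᵗ : Im Z > 0}`. -/
def siegelHalfSpace (σ : Type) : Set (SymMat σ) :=
  {Z | (Z.toMatrix.map Complex.im).PosDef}

/-- The block diagonal matrix `(z 0; 0 w)`. -/
def blockDiag {n : ℕ} (z w : SymMat (Fin n)) : SymMat (Fin n ⊕ Fin n) :=
  symOfMatrix (Matrix.fromBlocks z.toMatrix 0 0 w.toMatrix)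

section Action

variable {σ : Type} [Fintype σ] [DecidableEq σ]

/-- `C Z + D` for `M = (A B; C D)`. -/
def autDenom (M : Matrix (σ ⊕ σ) (σ ⊕ σ) ℝ) (Z : SymMat σ) : Matrix σ σ ℂ :=
  M.toBlocks₂₁.map Complex.ofReal * Z.toMatrix + M.toBlocks₂₂.map Complex.ofReal

/-- `M⟨Z⟩ = (A Z + B) (C Z + D)⁻¹` for `M = (A B; C D)`. -/
def moebius (M : Matrix (σ ⊕ σ) (σ ⊕ σ) ℝ) (Z : SymMat σ) : SymMat σ :=
  symOfMatrix ((M.toBlocks₁₁.map Complex.ofReal * Z.toMatrix + M.toBlocks₁₂.map Complex.ofReal)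
    * (autDenom M Z)⁻¹)

/-- `L` is a holomorphic branch of `log det (C Z + D)` on the Siegel upper half space, so that
`exp (s * L Z)` is a branch of `det (C Z + D) ^ s`. -/
def IsLogDet (M : Matrix (σ ⊕ σ) (σ ⊕ σ) ℝ) (L : SymMat σ → ℂ) : Prop :=
  DifferentiableOn ℂ L (siegelHalfSpace σ) ∧
    ∀ Z ∈ siegelHalfSpace σ, Complex.exp (L Z) = (autDenom M Z).det

/-- The scalar weight `s` slash operator
`(F |_s M)(Z) = det (C Z + D) ^ (-s) * F (M⟨Z⟩)`, for the branch of the power given by `L`. -/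
def slash (s : ℂ) (M : Matrix (σ ⊕ σ) (σ ⊕ σ) ℝ) (L F : SymMat σ → ℂ) : SymMat σ → ℂ :=
  fun Z => Complex.exp (-s * L Z) * F (moebius M Z)

end Action

/-- The product `M₁^↑ M₂^↓` of the standard embeddings of two `2n × 2n` matrices into the
`4n × 4n` matrices:
`((A B; C D), (a b; c d)) ↦ (A 0 B 0; 0 a 0 b; C 0 D 0; 0 c 0 d)`. -/
def upDown {n : ℕ} (M₁ M₂ : Matrix (Fin n ⊕ Fin n) (Fin n ⊕ Fin n) ℝ) :
    Matrix ((Fin n ⊕ Fin n) ⊕ (Fin n ⊕ Fin n)) ((Fin n ⊕ Fin n) ⊕ (Fin n ⊕ Fin n)) ℝ :=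
  Matrix.fromBlocks
    (Matrix.fromBlocks M₁.toBlocks₁₁ 0 0 M₂.toBlocks₁₁)
    (Matrix.fromBlocks M₁.toBlocks₁₂ 0 0 M₂.toBlocks₁₂)
    (Matrix.fromBlocks M₁.toBlocks₂₁ 0 0 M₂.toBlocks₂₁)
    (Matrix.fromBlocks M₁.toBlocks₂₂ 0 0 M₂.toBlocks₂₂)

/-! ### Vector valued polynomials on symmetric matrices and their differential operators -/

/-- `W`-valued polynomials in the entries `x_{ij} = x_{ji}` of a symmetric matrix of variables:
a coefficient in `W` for each monomial. -/
abbrev SymPoly (σ W : Type*) [Zero W] : Type _ := (Sym2 σ →₀ ℕ) →₀ W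

section Operators

variable {σ : Type} {W : Type*} [AddCommGroup W] [Module ℂ W]

/-- The value of a polynomial at a symmetric matrix. -/
def SymPoly.eval (Q : SymPoly σ W) (X : SymMat σ) : W :=
  Finsupp.sum Q fun m c => (Finsupp.prod m fun p k => X p ^ k) • c

variable [Fintype σ] [DecidableEq σ]

/-- `∂_{ij} = ((1 + δ_{ij}) / 2) ∂/∂z_{ij}`, normalized so that
`∂_{ij} exp (tr (T Z)) = T_{ij} exp (tr (T Z))`. -/
def partialD (p : Sym2 σ) (F : SymMat σ → ℂ) : SymMat σ → ℂ :=
  fun Z => (if p.IsDiag then 1 else 1 / 2) * fderiv ℂ F Z (Pi.single p 1)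

/-- The differential monomial `∂^m`. The factors are composed in some order, which
does not matter where `F` is holomorphic. -/
def monomialD (m : Sym2 σ →₀ ℕ) (F : SymMat σ → ℂ) : SymMat σ → ℂ :=
  (Finsupp.toMultiset m).toList.foldr partialD F

/-- `Q((∂_{ij})) F`. -/
def SymPoly.diffOp (Q : SymPoly σ W) (F : SymMat σ → ℂ) (Z : SymMat σ) : W :=
  Finsupp.sum Q fun m c => monomialD m F Z • c

end Operators

/-- `(Δ F)(z, w) = (Q((∂_{ij})) F)(z 0; 0 w)`. -/
def pullbackOp {n : ℕ} {W : Type*} [AddCommGroup W] [Module ℂ W]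
    (Q : SymPoly (Fin n ⊕ Fin n) W) (F : SymMat (Fin n ⊕ Fin n) → ℂ) (z w : SymMat (Fin n)) : W :=
  Q.diffOp F (blockDiag z w)

/-! ### Representations of `GL(n)` -/

section Reps

variable {n : ℕ} {V : Type*} [AddCommGroup V] [Module ℂ V]

/-- The matrix coefficients of `ρ` are polynomial functions of the matrix entries. -/
def IsPolynomialRep (ρ : Representation ℂ (GL (Fin n) ℂ) V) : Prop :=
  ∀ (φ : Module.Dual ℂ V) (v : V), ∃ p : MvPolynomial (Fin n × Fin n) ℂ, ∀ g : GL (Fin n) ℂ,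
    φ (ρ g v) = MvPolynomial.eval (fun ij => (g : Matrix (Fin n) (Fin n) ℂ) ij.1 ij.2) p

/-- `⟨v₁, ρ(g) v₂⟩ = ⟨ρ(gᵗ) v₁, v₂⟩` for all `g`. -/
def IsTransposeInvariant (ρ : Representation ℂ (GL (Fin n) ℂ) V)
    (B : LinearMap.BilinForm ℂ V) : Prop :=
  ∀ g h : GL (Fin n) ℂ, (h : Matrix (Fin n) (Fin n) ℂ) = (g : Matrix (Fin n) (Fin n) ℂ)ᵀ →
    ∀ v₁ v₂ : V, B v₁ (ρ g v₂) = B (ρ h v₁) v₂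

/-- The map `V ⊗ V → End V` with `(v₁ ⊗ v₂)^• (v) = ⟨v, v₁⟩ v₂`. -/
def bullet (B : LinearMap.BilinForm ℂ V) : V ⊗[ℂ] V →ₗ[ℂ] Module.End ℂ V :=
  dualTensorHom ℂ V V ∘ₗ TensorProduct.map B.flip LinearMap.id

/-- The operator `Δ` attached to `Q` is covariant of weight `s`:
`(Δ F) |^z_{det^s ⊗ ρ} M₁ |^w_{det^s ⊗ ρ} M₂ = Δ (F |_s M₁^↑ M₂^↓)`
on `H_n × H_n`, for all `M₁, M₂ ∈ Sp(n, ℝ)` and all holomorphic `F` on `H_{2n}`, where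
`(f |_{det^s ⊗ ρ} M)(z) = det (c z + d) ^ (-s) ρ(c z + d)⁻¹ f(M⟨z⟩)`. Since
`det (C Z + D) = det (c₁ z + d₁) det (c₂ w + d₂)` at `Z = (z 0; 0 w)`, a branch of
`det (C Z + D) ^ s` on `H_{2n}` also provides the power of the product of the determinants on
the left; passing to another branch multiplies both sides by the same constant. -/
def IsCovariant (ρ : Representation ℂ (GL (Fin n) ℂ) V) (s : ℂ)
    (Q : SymPoly (Fin n ⊕ Fin n) (V ⊗[ℂ] V)) : Prop :=
  ∀ M₁ ∈ Matrix.symplecticGroup (Fin n) ℝ, ∀ M₂ ∈ Matrix.symplecticGroup (Fin n) ℝ,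
  ∀ L : SymMat (Fin n ⊕ Fin n) → ℂ, IsLogDet (upDown M₁ M₂) L →
  ∀ F : SymMat (Fin n ⊕ Fin n) → ℂ, DifferentiableOn ℂ F (siegelHalfSpace (Fin n ⊕ Fin n)) →
  ∀ z ∈ siegelHalfSpace (Fin n), ∀ w ∈ siegelHalfSpace (Fin n),
  ∀ g₁ g₂ : GL (Fin n) ℂ,
    (g₁ : Matrix (Fin n) (Fin n) ℂ) = autDenom M₁ z →
    (g₂ : Matrix (Fin n) (Fin n) ℂ) = autDenom M₂ w →
    Complex.exp (-s * L (blockDiag z w)) •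
        TensorProduct.map (ρ g₁⁻¹) (ρ g₂⁻¹) (pullbackOp Q F (moebius M₁ z) (moebius M₂ w)) =
      pullbackOp Q (slash s (upDown M₁ M₂) L F) z w

end Reps

/-- The value `Q(A, U, C)` of a polynomial at the real symmetric matrix `(A U; Uᵗ C)`. -/
def evalBlocks {n : ℕ} {W : Type*} [AddCommGroup W] [Module ℂ W]
    (Q : SymPoly (Fin n ⊕ Fin n) W) (A U C : Matrix (Fin n) (Fin n) ℝ) : W :=
  Q.eval (symOfMatrix ((Matrix.fromBlocks A U Uᵀ C).map Complex.ofReal))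

/-- `P(X, Y) = Q(XᵗX, XᵗY, YᵗY)` for real `l × n` matrices `X`, `Y`. -/
def gramPoly {n l : ℕ} {W : Type*} [AddCommGroup W] [Module ℂ W]
    (Q : SymPoly (Fin n ⊕ Fin n) W) (X Y : Matrix (Fin l) (Fin n) ℝ) : W :=
  evalBlocks Q (Xᵀ * X) (Xᵀ * Y) (Yᵀ * Y)

end SiegelDiff

end

/-! Write P(X, Y) = Q(XᵗX, XᵗY, YᵗY). Covariance is needed only on exponentials Z ↦ exp(tr(TZ)), on
which Q(∂) multiplies by Q(T), and only for two kinds of symplectic matrices. Levi elements give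
equivariance of Q under ρ(d₁) ⊗ ρ(d₂) (`map_rep_eval`). Lower unipotents (1 0; ε v vᵗ 1) acting on
z, in weight l/2 and to first order in ε, say that every coordinate of X ↦ P(X, Y) is pluriharmonic
(`isPluriharmonic_gramSubst`).

Pluriharmonic polynomials are orthogonal, for the Fischer pairing, to the ideal generated by the
entries of XᵗX. Modulo this ideal P(X, Y) becomes Q(0, XᵗY, YᵗY), a polynomial in YᵗX. For real Y
the substitutions X ↦ YᵗX and Z ↦ YZ are adjoint, so a coordinate of P(·, Y) vanishes identically as
soon as either its reduction Q(0, ·, YᵗY) vanishes or it vanishes at all X = YZ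
(`IsPluriharmonic.eq_zero`). Both criteria are used.

By equivariance and Schur's lemma, Q(0, U, C) does not depend on C and Q(0, 1, 0)^• is a scalar c.
If c = 0, the first criterion kills all P(X, Y); since l ≥ 2n, the matrices occurring as arguments
of Q include all real Gram matrices, which are Zariski dense, and Q = 0. Hence c ≠ 0
(`eval_blocks_one_ne_zero`).

Suppose Q(1, 1, 1)^• is not onto, and let u ≠ 0 be a functional killing its range. For Y with
orthonormal columns, equivariance makes u(P(X, Y)^• v) vanish at all X = Yg, hence at every complex
X by the second criterion. Again because l ≥ 2n, there is a second orthonormal frame Y' orthogonal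
to Y; the isotropic point X = Y + iY' satisfies XᵗX = 0 and XᵗY = 1, and there the value is c u(v).
So u = 0, a contradiction (`isUnit_bullet_eval_one`). Writing T = d dᵗ carries the result from 1 to
every positive definite T. -/

noncomputable section

namespace SiegelDiff

/-! ### The Fischer pairing and harmonic polynomials -/

section Fischer

open MvPolynomial

variable {σ τ : Type*}

/-- The Fischer pairing `∑ₘ m! fₘ gₘ` of two polynomials, as a linear form in `f`. -/
def fischer (g : MvPolynomial σ ℂ) : MvPolynomial σ ℂ →ₗ[ℂ] ℂ :=
  (basisMonomials σ ℂ).constr ℂ fun m => (m.prod fun _ k => (k.factorial : ℂ)) * coeff m g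

theorem fischer_monomial (g : MvPolynomial σ ℂ) (m : σ →₀ ℕ) (c : ℂ) :
    fischer g (monomial m c) = c * ((m.prod fun _ k => (k.factorial : ℂ)) * coeff m g) := by
  have h : monomial m c = c • basisMonomials σ ℂ m := by
    simp [smul_monomial]
  rw [h, map_smul, fischer, Module.Basis.constr_basis, smul_eq_mul]

theorem fischer_add_left (g₁ g₂ f : MvPolynomial σ ℂ) :
    fischer (g₁ + g₂) f = fischer g₁ f + fischer g₂ f := by
  induction f using MvPolynomial.induction_on' with
  | monomial m c => simp only [fischer_monomial, coeff_add]; ring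
  | add p q hp hq => rw [map_add, map_add, map_add, hp, hq]; ring

theorem fischer_smul_left (a : ℂ) (g f : MvPolynomial σ ℂ) :
    fischer (a • g) f = a * fischer g f := by
  induction f using MvPolynomial.induction_on' with
  | monomial m c => simp only [fischer_monomial, coeff_smul, smul_eq_mul]; ring
  | add p q hp hq => rw [map_add, map_add, hp, hq]; ring

theorem fischer_zero_left (f : MvPolynomial σ ℂ) : fischer 0 f = 0 := by
  simpa using fischer_smul_left 0 0 f

theorem fischer_sum_left {ι : Type*} (s : Finset ι) (g : ι → MvPolynomial σ ℂ)
    (f : MvPolynomial σ ℂ) : fischer (∑ i ∈ s, g i) f = ∑ i ∈ s, fischer (g i) f := by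
  classical
  induction s using Finset.induction_on with
  | empty => simp [fischer_zero_left]
  | insert a s ha ih => rw [Finset.sum_insert ha, Finset.sum_insert ha, fischer_add_left, ih]

/-- The factor m i + 1 is the one produced by differentiating x^(m + e_i), so the factorial weights
make multiplication by a variable adjoint to differentiation. -/
theorem prod_factorial_add_single (m : σ →₀ ℕ) (i : σ) :
    ((m + Finsupp.single i 1).prod fun _ k => (k.factorial : ℂ)) =
      (m i + 1) * m.prod fun _ k => (k.factorial : ℂ) := by
  classical
  have h1 : ∀ m' : σ →₀ ℕ, m'.support ⊆ insert i m.support →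
      (m'.prod fun _ k => (k.factorial : ℂ)) =
        ∏ j ∈ insert i m.support, ((m' j).factorial : ℂ) := fun m' hm' =>
    Finsupp.prod_of_support_subset _ hm' _ (by simp)
  rw [h1 _ (Finsupp.support_add.trans (Finset.union_subset (Finset.subset_insert _ _)
      (Finsupp.support_single_subset.trans (by simp)))), h1 m (Finset.subset_insert _ _)]
  rw [← Finset.mul_prod_erase _ _ (Finset.mem_insert_self i m.support),
    ← Finset.mul_prod_erase _ _ (Finset.mem_insert_self i m.support), ← mul_assoc]
  congr 1
  · simp [Nat.factorial_succ]
  · refine Finset.prod_congr rfl fun j hj => ?_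
    have : i ≠ j := (Finset.ne_of_mem_erase hj).symm
    simp [Finsupp.single_eq_of_ne' this]

/-- Multiplication by a variable is adjoint to the partial derivative. -/
theorem fischer_mul_X (g f : MvPolynomial σ ℂ) (i : σ) :
    fischer g (f * X i) = fischer (pderiv i g) f := by
  induction f using MvPolynomial.induction_on' with
  | monomial m c =>
    rw [X, monomial_mul, mul_one, fischer_monomial, fischer_monomial, coeff_pderiv,
      prod_factorial_add_single]
    ring
  | add p q hp hq => rw [add_mul, map_add, map_add, hp, hq]

/-- Pairing f with its conjugate gives ∑ m! |f_m|²: the bilinear pairing becomes a positive definite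
Hermitian form. -/
theorem fischer_conj_self (f : MvPolynomial σ ℂ)
    (h : fischer (map (starRingEnd ℂ) f) f = 0) : f = 0 := by
  have h1 : fischer (map (starRingEnd ℂ) f) f =
      ((∑ m ∈ f.support, (m.prod fun _ k => (k.factorial : ℝ)) * Complex.normSq (coeff m f) : ℝ)
        : ℂ) := by
    conv_lhs => rw [f.as_sum, map_sum, ← f.as_sum]
    push_cast
    refine Finset.sum_congr rfl fun m _ => ?_
    rw [fischer_monomial, coeff_map, Complex.normSq_eq_conj_mul_self]
    simp only [Finsupp.prod]
    push_cast
    ring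
  rw [h1, Complex.ofReal_eq_zero, Finset.sum_eq_zero_iff_of_nonneg] at h
  · ext m
    by_contra hm
    have h2 := h m (mem_support_iff.2 hm)
    have h3 : (m.prod fun _ k => (k.factorial : ℝ)) ≠ 0 :=
      Finset.prod_ne_zero_iff.2 fun i _ => Nat.cast_ne_zero.2 (m i).factorial_ne_zero
    exact hm (by simpa [h3] using h2)
  · exact fun m _ => mul_nonneg (Finset.prod_nonneg fun i _ => by positivity)
      (Complex.normSq_nonneg _)

variable [Fintype τ]

/-- The linear substitution `x_i ↦ ∑ⱼ A_{ji} x_j`. -/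
def linSubst (A : Matrix τ σ ℂ) : MvPolynomial σ ℂ →ₐ[ℂ] MvPolynomial τ ℂ :=
  aeval fun i => ∑ j, A j i • X j

theorem eval_linSubst (A : Matrix τ σ ℂ) (f : MvPolynomial σ ℂ) (x : τ → ℂ) :
    eval x (linSubst A f) = eval (fun i => ∑ j, A j i * x j) f := by
  have : (aeval x).comp (linSubst A) = aeval (R := ℂ) fun i => ∑ j, A j i * x j := by
    apply MvPolynomial.algHom_ext
    intro i
    simp [linSubst, map_sum]
  have h2 := DFunLike.congr_fun this f
  simpa [aeval_eq_eval] using h2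

theorem pderiv_linSubst [Fintype σ] (A : Matrix τ σ ℂ) (f : MvPolynomial σ ℂ) (j : τ) :
    pderiv j (linSubst A f) = ∑ i, A j i • linSubst A (pderiv i f) := by
  classical
  induction f using MvPolynomial.induction_on with
  | C a => simp [linSubst]
  | add p q hp hq => simp only [map_add, hp, hq, smul_add, Finset.sum_add_distrib]
  | mul_X p i hp =>
    have h1 : pderiv j (linSubst A (X i)) = C (A j i) := by
      simp only [linSubst, aeval_X, map_sum, Derivation.map_smul]
      rw [Finset.sum_eq_single j]
      · simp [smul_eq_C_mul]
      · intro b _ hb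
        rw [pderiv_X_of_ne hb, smul_zero]
      · simp
    rw [map_mul, Derivation.leibniz, hp, h1]
    simp only [Derivation.leibniz, smul_eq_mul, map_add, map_mul, smul_add,
      Finset.sum_add_distrib]
    congr 1
    · rw [Finset.sum_eq_single i]
      · simp [smul_eq_C_mul, mul_comm]
      · intro b _ hb
        rw [pderiv_X_of_ne hb.symm]; simp
      · simp
    · rw [Finset.mul_sum]
      exact Finset.sum_congr rfl fun b _ => by rw [mul_smul_comm]

theorem fischer_C (g : MvPolynomial σ ℂ) (c : ℂ) : fischer g (C c) = c * coeff 0 g := by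
  rw [← monomial_zero', fischer_monomial]; simp

/-- The adjoint of a linear substitution is the transposed linear substitution. -/
theorem fischer_linSubst [Fintype σ] (A : Matrix τ σ ℂ) (f : MvPolynomial σ ℂ) (g : MvPolynomial τ ℂ) :
    fischer g (linSubst A f) = fischer (linSubst Aᵀ g) f := by
  induction f using MvPolynomial.induction_on generalizing g with
  | C a =>
    have h : linSubst A (C a) = C a := by simp [linSubst, algebraMap_eq]
    rw [h, fischer_C, fischer_C]
    have := eval_linSubst Aᵀ g 0
    simp only [Pi.zero_apply, mul_zero, Finset.sum_const_zero] at this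
    rw [← constantCoeff_eq, ← constantCoeff_eq]
    have e1 : eval (fun _ => (0 : ℂ)) (linSubst Aᵀ g) = constantCoeff (linSubst Aᵀ g) := by
      rw [← eval_zero']
    have e2 : eval (fun _ => (0 : ℂ)) g = constantCoeff g := by rw [← eval_zero']
    rw [← e1, ← e2, ← this]
    rfl
  | add p q hp hq => rw [map_add, map_add, map_add, hp, hq]
  | mul_X p i hp =>
    have h1 : linSubst A (X i) = ∑ j, A j i • X j := by simp [linSubst]
    rw [map_mul, h1, Finset.mul_sum, map_sum, fischer_mul_X, pderiv_linSubst, fischer_sum_left]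
    refine Finset.sum_congr rfl fun j _ => ?_
    rw [mul_smul_comm, map_smul, fischer_mul_X, hp, fischer_smul_left]
    rfl

/-- This is where reality of Y enters: conjugation has to pass through the substitution for the
adjoint to be usable with the Hermitian form. -/
theorem linSubst_map_conj (A : Matrix τ σ ℂ) (hA : ∀ i j, starRingEnd ℂ (A i j) = A i j)
    (f : MvPolynomial σ ℂ) :
    linSubst A (map (starRingEnd ℂ) f) = map (starRingEnd ℂ) (linSubst A f) := by
  induction f using MvPolynomial.induction_on with
  | C a => simp [linSubst, algebraMap_eq]
  | add p q hp hq => simp only [map_add, hp, hq]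
  | mul_X p i hp =>
    simp only [map_mul, hp]
    congr 1
    simp [linSubst, smul_eq_C_mul, map_sum, hA]

end Fischer

/-! ### Pluriharmonic polynomials and the vanishing criterion -/

section Harmonic

open MvPolynomial

variable {κ ν : Type*} [Fintype κ]

/-- Pluriharmonic polynomials on `κ × ν` matrices. -/
def IsPluriharmonic (f : MvPolynomial (κ × ν) ℂ) : Prop :=
  ∀ i j : ν, ∑ k : κ, pderiv (k, i) (pderiv (k, j) f) = 0

/-- The entries of `Xᵗ X` as polynomials in the entries of `X`. -/
def gramEntry (κ : Type*) [Fintype κ] {ν : Type*} (p : ν × ν) : MvPolynomial (κ × ν) ℂ :=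
  ∑ k : κ, X (k, p.1) * X (k, p.2)

theorem IsPluriharmonic.map_conj {f : MvPolynomial (κ × ν) ℂ} (hf : IsPluriharmonic f) :
    IsPluriharmonic (map (starRingEnd ℂ) f) := by
  intro i j
  simp only [pderiv_map]
  rw [← map_sum, hf i j, map_zero]

/-- Pluriharmonic polynomials are orthogonal to the ideal generated by the entries of `Xᵗ X`. -/
theorem IsPluriharmonic.fischer_eq_zero {f h : MvPolynomial (κ × ν) ℂ} (hf : IsPluriharmonic f)
    (hh : h ∈ Ideal.span (Set.range (gramEntry κ (ν := ν)))) : fischer f h = 0 := by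
  suffices H : ∀ g, fischer f (g * h) = 0 by simpa using H 1
  induction hh using Submodule.span_induction with
  | mem x hx =>
    obtain ⟨⟨i, j⟩, rfl⟩ := hx
    intro g
    rw [gramEntry, Finset.mul_sum, map_sum]
    simp_rw [← mul_assoc, fischer_mul_X]
    rw [← fischer_sum_left]
    have := hf i j
    rw [this, fischer_zero_left]
  | zero => simp
  | add x y _ _ hx hy => intro g; rw [mul_add, map_add, hx, hy, add_zero]
  | smul a x _ hx => intro g; rw [smul_eq_mul, ← mul_assoc]; exact hx _

variable [Fintype ν] {μ : Type*} [Fintype μ] [DecidableEq ν]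

/-- The matrix of the linear map `X ↦ Yᵗ X`. -/
def leftMulMatrix (ν : Type*) [DecidableEq ν] (Y : Matrix κ μ ℂ) : Matrix (κ × ν) (μ × ν) ℂ :=
  Matrix.of fun p q => if p.2 = q.2 then Y p.1 q.1 else 0

/-- A pluriharmonic polynomial which is congruent to a polynomial `G` in `Yᵗ X` modulo the
entries of `Xᵗ X` vanishes, if `G = 0` or if it vanishes on all `Y Z`. -/
theorem IsPluriharmonic.eq_zero {f : MvPolynomial (κ × ν) ℂ} (hf : IsPluriharmonic f)
    (Y : Matrix κ μ ℝ) (G : MvPolynomial (μ × ν) ℂ)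
    (hG : f - linSubst (leftMulMatrix ν (Y.map Complex.ofReal)) G ∈
      Ideal.span (Set.range (gramEntry κ (ν := ν))))
    (h0 : G = 0 ∨ linSubst (leftMulMatrix ν (Y.map Complex.ofReal))ᵀ f = 0) : f = 0 := by
  apply fischer_conj_self
  set A := leftMulMatrix ν (Y.map Complex.ofReal)
  have h1 := hf.map_conj.fischer_eq_zero hG
  rw [map_sub, sub_eq_zero] at h1
  rw [h1]
  rcases h0 with rfl | h0
  · simp
  rw [fischer_linSubst]
  have h2 : linSubst Aᵀ (map (starRingEnd ℂ) f) = map (starRingEnd ℂ) (linSubst Aᵀ f) :=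
    linSubst_map_conj _ (fun i j => by
      simp only [A, leftMulMatrix, Matrix.transpose_apply, Matrix.of_apply, Matrix.map_apply]
      split_ifs <;> simp) f
  rw [h2, h0, map_zero, fischer_zero_left]

end Harmonic

/-! ### Zariski density of real points -/

section Density

open MvPolynomial

variable {ν : Type*} [Fintype ν] [DecidableEq ν]

theorem eq_zero_of_eval_ofReal {σ : Type*} (p : MvPolynomial σ ℂ)
    (h : ∀ x : σ → ℝ, eval (fun i => (x i : ℂ)) p = 0) : p = 0 := by
  refine MvPolynomial.funext_set (fun _ => Set.range Complex.ofReal)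
    (fun _ => Set.infinite_range_of_injective Complex.ofReal_injective) fun x hx => ?_
  choose y hy using fun i => hx i (Set.mem_univ i)
  rw [map_zero, ← h y]
  congr 2
  ext i
  exact (hy i).symm

/-- `GL(ν, ℝ)` is Zariski dense in the complex matrices. -/
theorem eq_zero_of_eval_GL (p : MvPolynomial (ν × ν) ℂ)
    (h : ∀ g : GL ν ℝ, eval (fun ij => ((g : Matrix ν ν ℝ) ij.1 ij.2 : ℂ)) p = 0) : p = 0 := by
  -- Multiplication by the determinant gives a polynomial vanishing at every real matrix, singular
  -- or not. The polynomial ring is a domain, and D ≠ 0 because det 1 = 1.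
  let D : MvPolynomial (ν × ν) ℂ := (Matrix.of fun i j => X (i, j)).det
  have hD : ∀ x : ν × ν → ℂ, eval x D = (Matrix.of fun i j => x (i, j)).det := by
    intro x
    simp only [D]
    rw [RingHom.map_det]
    congr 1
    ext i j
    simp
  have h0 : p * D = 0 := by
    apply eq_zero_of_eval_ofReal
    intro x
    rw [map_mul, hD]
    by_cases hx : (Matrix.of fun i j => x (i, j)).det = 0
    · have : (Matrix.of fun i j => (x (i, j) : ℂ)).det = 0 := by
        have h2 := congrArg Complex.ofReal hx
        rw [← Complex.ofRealHom_eq_coe, RingHom.map_det] at h2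
        rw [Complex.ofReal_zero] at h2
        exact h2
      rw [this, mul_zero]
    · have := h (Matrix.GeneralLinearGroup.mkOfDetNeZero _ hx)
      have e : (fun i => (x i : ℂ)) = fun ij : ν × ν =>
          ((Matrix.GeneralLinearGroup.mkOfDetNeZero _ hx : GL ν ℝ).1 ij.1 ij.2 : ℂ) := by
        ext ij
        rfl
      rw [e, this, zero_mul]
  rcases mul_eq_zero.1 h0 with h1 | h1
  · exact h1
  · have h2 := hD fun ij => if ij.1 = ij.2 then 1 else 0
    have h3 : (Matrix.of fun i j : ν => if (i, j).1 = (i, j).2 then (1 : ℂ) else 0) = 1 := by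
      ext i j
      simp [Matrix.one_apply]
    rw [h1, map_zero, h3, Matrix.det_one] at h2
    exact absurd h2 zero_ne_one

end Density

/-! ### Second derivatives along lines -/

section Derivatives

open MvPolynomial

variable {σ : Type*} [Fintype σ]

theorem hasDerivAt_eval_line (f : MvPolynomial σ ℂ) (x v : σ → ℂ) (t : ℂ) :
    HasDerivAt (fun t : ℂ => eval (fun i => x i + t * v i) f)
      (∑ i, v i * eval (fun i => x i + t * v i) (pderiv i f)) t := by
  classical
  induction f using MvPolynomial.induction_on with
  | C a => simpa using hasDerivAt_const t a
  | add p q hp hq =>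
    simp only [map_add, mul_add, Finset.sum_add_distrib]
    exact HasDerivAt.fun_add hp hq
  | mul_X p i hp =>
    have h1 : HasDerivAt (fun t : ℂ => x i + t * v i) (v i) t := by
      simpa using ((hasDerivAt_id t).mul_const (v i)).const_add (x i)
    have h2 := HasDerivAt.fun_mul hp h1
    simp only [map_mul, eval_X]
    refine h2.congr_deriv (Eq.symm ?_)
    have h3 : ∀ j, pderiv j (p * X i) = pderiv j p * X i + if i = j then p else 0 := by
      intro j
      rw [Derivation.leibniz, add_comm]
      split_ifs with hij
      · subst hij; simp [mul_comm]
      · simp [pderiv_X_of_ne hij, mul_comm]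
    simp only [h3, map_add, map_mul, eval_X, mul_add, Finset.sum_add_distrib, Finset.sum_mul,
      mul_assoc]
    refine congrArg₂ (· + ·) rfl ?_
    · rw [Finset.sum_eq_single i]
      · simp [mul_comm]
      · intro b _ hb; simp [hb.symm]
      · simp

theorem deriv_deriv_eval_line (f : MvPolynomial σ ℂ) (x v : σ → ℂ) :
    deriv (deriv fun t : ℂ => eval (fun i => x i + t * v i) f) 0 =
      ∑ i, ∑ j, v i * v j * eval x (pderiv j (pderiv i f)) := by
  have h1 : (deriv fun t : ℂ => eval (fun i => x i + t * v i) f) = fun t =>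
      ∑ i, v i * eval (fun i => x i + t * v i) (pderiv i f) :=
    funext fun t => (hasDerivAt_eval_line f x v t).deriv
  rw [h1]
  have h2 := HasDerivAt.fun_sum (u := Finset.univ) fun i _ =>
    (hasDerivAt_eval_line (pderiv i f) x v 0).const_mul (v i)
  rw [h2.deriv]
  refine Finset.sum_congr rfl fun i _ => ?_
  rw [Finset.mul_sum]
  refine Finset.sum_congr rfl fun j _ => ?_
  simp [mul_assoc]

theorem pderiv_comm {σ : Type*} (i j : σ) (f : MvPolynomial σ ℂ) :
    pderiv i (pderiv j f) = pderiv j (pderiv i f) := by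
  ext m
  simp only [coeff_pderiv, add_right_comm m (Finsupp.single i 1) (Finsupp.single j 1)]
  by_cases h : i = j
  · subst h; rfl
  · simp [Finsupp.single_eq_of_ne' h, Finsupp.single_eq_of_ne h]; ring

/-- A criterion for pluriharmonicity by second derivatives along lines. -/
theorem isPluriharmonic_of_deriv {κ ν : Type*} [Fintype κ] [Fintype ν] [DecidableEq κ]
    (f : MvPolynomial (κ × ν) ℂ)
    (h : ∀ (x : κ × ν → ℂ) (v : ν → ℝ), ∑ k : κ, deriv (deriv fun t : ℂ =>
      eval (fun p => x p + t * (if p.1 = k then (v p.2 : ℂ) else 0)) f) 0 = 0) :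
    IsPluriharmonic f := by
  classical
  have key : ∀ (x : κ × ν → ℂ) (v : ν → ℝ),
      ∑ i, ∑ j, (v i : ℂ) * v j * eval x (∑ k : κ, pderiv (k, j) (pderiv (k, i) f)) = 0 := by
    intro x v
    rw [← h x v]
    have h1 : ∀ k : κ, deriv (deriv fun t : ℂ =>
        eval (fun p => x p + t * (if p.1 = k then (v p.2 : ℂ) else 0)) f) 0 =
        ∑ i, ∑ j, (v i : ℂ) * v j * eval x (pderiv (k, j) (pderiv (k, i) f)) := by
      intro k
      rw [deriv_deriv_eval_line, Fintype.sum_prod_type, Finset.sum_eq_single k]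
      · refine Finset.sum_congr rfl fun i _ => ?_
        rw [Fintype.sum_prod_type, Finset.sum_eq_single k]
        · simp
        · intro b _ hb; simp [hb]
        · simp
      · intro b _ hb; simp [hb]
      · simp
    simp_rw [h1]
    conv_rhs => rw [Finset.sum_comm]
    refine Finset.sum_congr rfl fun i _ => ?_
    conv_rhs => rw [Finset.sum_comm]
    refine Finset.sum_congr rfl fun j _ => ?_
    rw [map_sum, Finset.mul_sum]
  have hsymm : ∀ (x : κ × ν → ℂ) (i j : ν), eval x (∑ k : κ, pderiv (k, j) (pderiv (k, i) f)) =
      eval x (∑ k : κ, pderiv (k, i) (pderiv (k, j) f)) := by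
    intro x i j
    simp_rw [pderiv_comm (σ := κ × ν) (_, j)]
  intro i j
  apply MvPolynomial.funext
  intro x
  rw [map_zero]
  set b : ν → ν → ℂ := fun i j => eval x (∑ k : κ, pderiv (k, j) (pderiv (k, i) f)) with hb
  have hq : ∀ v : ν → ℝ, ∑ i, ∑ j, (v i : ℂ) * v j * b i j = 0 := key x
  -- Polarization: a symmetric form whose quadratic form vanishes on real vectors is zero, tested on
  -- e_i and then on e_i + e_j.
  have hd : ∀ i, b i i = 0 := by
    intro i
    have := hq (Pi.single i 1)
    simpa [Pi.single_apply, apply_ite Complex.ofReal] using this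
  rw [hsymm x j i]
  change b i j = 0
  by_cases hij : i = j
  · subst hij; exact hd i
  have h3 := hq (Pi.single i 1 + Pi.single j 1)
  simp only [Pi.add_apply, Complex.ofReal_add, add_mul, mul_add, Finset.sum_add_distrib] at h3
  have h4 : b j i = b i j := hsymm x j i
  simp [Pi.single_apply, apply_ite Complex.ofReal, hd, h4] at h3
  exact h3

end Derivatives

/-! ### Gram substitutions modulo the entries of XᵗX -/

section Blocks

open MvPolynomial

variable {n : ℕ} {κ : Type*} [Fintype κ]

/-- The symmetric matrix `(A U; Uᵗ C)`, for symmetric `A` and `C`. -/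
def blocks (A U C : Matrix (Fin n) (Fin n) ℂ) : SymMat (Fin n ⊕ Fin n) :=
  symOfMatrix (Matrix.fromBlocks A U Uᵀ C)

/-- The entries of the symmetric part of a matrix over a `ℂ`-algebra. -/
def symEntries {σ R : Type*} [AddCommGroup R] [Module ℂ R] (M : Matrix σ σ R) : Sym2 σ → R :=
  Sym2.lift ⟨fun i j => (1 / 2 : ℂ) • (M i j + M j i), fun i j => congrArg _ (add_comm (M i j) (M j i))⟩

theorem symOfMatrix_eq_symEntries {σ : Type} (M : Matrix σ σ ℂ) :
    symOfMatrix M = symEntries M := by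
  ext p
  induction p with
  | h i j => simp [symOfMatrix, symEntries]; ring

theorem eval_symEntries {σ τ : Type*} (x : τ → ℂ) (M : Matrix σ σ (MvPolynomial τ ℂ))
    (q : MvPolynomial (Sym2 σ) ℂ) :
    eval x (aeval (symEntries M) q) = eval (symEntries (M.map (eval x))) q := by
  have h : (aeval x).comp (aeval (symEntries M)) =
      aeval (R := ℂ) (symEntries (M.map (eval x))) := by
    apply MvPolynomial.algHom_ext
    intro p
    induction p with
    | h i j => simp [symEntries, aeval_eq_eval, mul_add]
  simpa [aeval_eq_eval] using DFunLike.congr_fun h q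

/-- The matrix `(A U; Uᵗ YᵗY)` with `U = XᵗY` over the polynomials in the entries of `X`. -/
def gramMatrix (A : Matrix (Fin n) (Fin n) (MvPolynomial (κ × Fin n) ℂ))
    (Y : Matrix κ (Fin n) ℂ) :
    Matrix (Fin n ⊕ Fin n) (Fin n ⊕ Fin n) (MvPolynomial (κ × Fin n) ℂ) :=
  Matrix.fromBlocks A (Matrix.of fun i j => ∑ k, Y k j • X (k, i))
    (Matrix.of fun i j => ∑ k, Y k j • X (k, i))ᵀ ((Yᵀ * Y).map C)

/-- The polynomial `X ↦ q(XᵗX, XᵗY, YᵗY)`. -/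
def gramSubst (Y : Matrix κ (Fin n) ℂ) (q : MvPolynomial (Sym2 (Fin n ⊕ Fin n)) ℂ) :
    MvPolynomial (κ × Fin n) ℂ :=
  aeval (symEntries (gramMatrix (Matrix.of fun i j => gramEntry κ (i, j)) Y)) q

theorem eval_gramSubst (Y : Matrix κ (Fin n) ℂ) (q : MvPolynomial (Sym2 (Fin n ⊕ Fin n)) ℂ)
    (x : κ × Fin n → ℂ) :
    eval x (gramSubst Y q) = eval (blocks ((Matrix.of fun k i => x (k, i))ᵀ *
      Matrix.of fun k i => x (k, i)) ((Matrix.of fun k i => x (k, i))ᵀ * Y) (Yᵀ * Y)) q := by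
  rw [gramSubst, eval_symEntries, blocks, symOfMatrix_eq_symEntries]
  congr 3
  ext (i | i) (j | j) <;>
    simp [gramMatrix, gramEntry, Matrix.mul_apply, map_sum, mul_comm]

/-- The polynomial `Z ↦ q(0, Zᵗ, C)`. -/
def offDiagSubst (S : Matrix (Fin n) (Fin n) ℂ) (q : MvPolynomial (Sym2 (Fin n ⊕ Fin n)) ℂ) :
    MvPolynomial (Fin n × Fin n) ℂ :=
  aeval (symEntries (Matrix.fromBlocks 0 (Matrix.of fun i j => X (j, i))
    (Matrix.of fun i j => X (j, i))ᵀ (S.map C))) q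

theorem eval_offDiagSubst (S : Matrix (Fin n) (Fin n) ℂ)
    (q : MvPolynomial (Sym2 (Fin n ⊕ Fin n)) ℂ) (x : Fin n × Fin n → ℂ) :
    eval x (offDiagSubst S q) = eval (blocks 0 (Matrix.of fun i j => x (j, i)) S) q := by
  rw [offDiagSubst, eval_symEntries, blocks, symOfMatrix_eq_symEntries]
  congr 3
  ext (i | i) (j | j) <;> simp

theorem aeval_sub_aeval_mem {σ R : Type*} [CommRing R] [Algebra ℂ R] (I : Ideal R) (x y : σ → R)
    (h : ∀ i, x i - y i ∈ I) (q : MvPolynomial σ ℂ) : aeval x q - aeval y q ∈ I := by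
  induction q using MvPolynomial.induction_on with
  | C a => simp
  | add p q hp hq => simpa [add_sub_add_comm] using I.add_mem hp hq
  | mul_X p i hp =>
    have : aeval x (p * X i) - aeval y (p * X i) =
        (aeval x p - aeval y p) * x i + aeval y p * (x i - y i) := by
      simp only [map_mul, aeval_X]; ring
    rw [this]
    exact I.add_mem (I.mul_mem_right _ hp) (I.mul_mem_left _ (h i))

/-- Modulo the ideal the block XᵗX can be replaced by 0. What remains involves X only through YᵗX,
the shape required by `IsPluriharmonic.eq_zero`. -/
theorem gramSubst_sub_mem (Y : Matrix κ (Fin n) ℂ) (q : MvPolynomial (Sym2 (Fin n ⊕ Fin n)) ℂ) :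
    gramSubst Y q - linSubst (leftMulMatrix (Fin n) Y) (offDiagSubst (Yᵀ * Y) q) ∈
      Ideal.span (Set.range (gramEntry κ (ν := Fin n))) := by
  have h : linSubst (leftMulMatrix (Fin n) Y) (offDiagSubst (Yᵀ * Y) q) =
      aeval (symEntries (gramMatrix 0 Y)) q := by
    rw [offDiagSubst, ← AlgHom.comp_apply]
    congr 1
    apply MvPolynomial.algHom_ext
    intro p
    have h1 : ∀ i j : Fin n, linSubst (leftMulMatrix (Fin n) Y) (X (j, i)) =
        ∑ k, Y k j • X (k, i) := by
      intro i j
      simp only [linSubst, aeval_X, leftMulMatrix, Matrix.of_apply, Fintype.sum_prod_type, ite_smul,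
        zero_smul, Finset.sum_ite_eq', Finset.mem_univ, if_true]
    have h2 : ∀ c, linSubst (leftMulMatrix (Fin n) Y) (C c) = C c := fun c => by
      rw [← algebraMap_eq, AlgHom.commutes, algebraMap_eq]
    induction p with
    | h i j =>
      rcases i with i | i <;> rcases j with j | j <;>
        simp [symEntries, gramMatrix, h1, h2, -Matrix.map_mul]
  rw [h, gramSubst]
  apply aeval_sub_aeval_mem
  intro p
  induction p with
  | h i j =>
    have hmem : ∀ i j, gramEntry κ (i, j) ∈ Ideal.span (Set.range (gramEntry κ (ν := Fin n))) :=
      fun i j => Ideal.subset_span ⟨_, rfl⟩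
    rcases i with i | i <;> rcases j with j | j <;>
      simp only [symEntries, gramMatrix, Sym2.lift_mk, Matrix.fromBlocks_apply₁₁,
        Matrix.fromBlocks_apply₁₂, Matrix.fromBlocks_apply₂₁, Matrix.fromBlocks_apply₂₂, sub_self,
        Submodule.zero_mem, Matrix.of_apply, Matrix.zero_apply, add_zero, smul_zero, sub_zero]
    exact Submodule.smul_of_tower_mem _ _ (add_mem (hmem i j) (hmem j i))

/-- A pluriharmonic `X ↦ q(XᵗX, XᵗY, YᵗY)` with `q(0, U, YᵗY) = 0` vanishes. -/
theorem gramSubst_eq_zero_of_offDiag (Y : Matrix κ (Fin n) ℝ)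
    (q : MvPolynomial (Sym2 (Fin n ⊕ Fin n)) ℂ)
    (hq : IsPluriharmonic (gramSubst (Y.map Complex.ofReal) q))
    (h0 : ∀ g : GL (Fin n) ℝ, eval (blocks 0 ((g : Matrix (Fin n) (Fin n) ℝ).map Complex.ofReal)
      ((Y.map Complex.ofReal)ᵀ * Y.map Complex.ofReal)) q = 0) :
    gramSubst (Y.map Complex.ofReal) q = 0 := by
  refine hq.eq_zero Y _ (gramSubst_sub_mem _ q) (Or.inl (eq_zero_of_eval_GL _ fun g => ?_))
  rw [eval_offDiagSubst]
  -- The transpose appears because `offDiagSubst` puts Zᵗ, with Z standing for YᵗX, in the upper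
  -- right block.
  refine Eq.trans ?_ (h0 (Matrix.GeneralLinearGroup.mkOfDetNeZero gᵀ ?_))
  · rfl
  · rw [Matrix.det_transpose]; exact g.det_ne_zero

/-- A pluriharmonic `X ↦ q(XᵗX, XᵗY, YᵗY)` which vanishes at all `X = Y Z` vanishes. -/
theorem gramSubst_eq_zero_of_mul (Y : Matrix κ (Fin n) ℝ)
    (q : MvPolynomial (Sym2 (Fin n ⊕ Fin n)) ℂ)
    (hq : IsPluriharmonic (gramSubst (Y.map Complex.ofReal) q))
    (h0 : ∀ g : GL (Fin n) ℝ, eval (fun p : κ × Fin n =>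
      ((Y * (g : Matrix (Fin n) (Fin n) ℝ)) p.1 p.2 : ℂ)) (gramSubst (Y.map Complex.ofReal) q) = 0) :
    gramSubst (Y.map Complex.ofReal) q = 0 := by
  refine hq.eq_zero Y _ (gramSubst_sub_mem _ q) (Or.inr (eq_zero_of_eval_GL _ fun g => ?_))
  rw [eval_linSubst, ← h0 g]
  congr 2
  ext ⟨k, i⟩
  simp [leftMulMatrix, Matrix.mul_apply, Fintype.sum_prod_type]

end Blocks

/-! ### Symmetry of second directional derivatives -/

section DirectionalDerivatives

variable {E : Type*} [NormedAddCommGroup E] [NormedSpace ℂ E]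

theorem analyticOnNhd_fderiv_apply {Φ : E → ℂ} {U : Set E} (hΦ : AnalyticOnNhd ℂ Φ U) (v : E) :
    AnalyticOnNhd ℂ (fun x => fderiv ℂ Φ x v) U := by
  intro x hx
  exact ((ContinuousLinearMap.apply ℂ ℂ v).analyticAt _).comp (hΦ.fderiv x hx)

theorem fderiv_fderiv_comm {Φ : E → ℂ} {x : E} (hΦ : AnalyticAt ℂ Φ x) (v w : E) :
    fderiv ℂ (fun y => fderiv ℂ Φ y v) x w = fderiv ℂ (fun y => fderiv ℂ Φ y w) x v := by
  have h1 : ContDiffAt ℂ 2 Φ x := hΦ.contDiffAt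
  have hd : DifferentiableAt ℂ (fderiv ℂ Φ) x := hΦ.fderiv.differentiableAt
  have h2 := h1.isSymmSndFDerivAt (by simp)
  have key : ∀ u : E, fderiv ℂ (fun y => fderiv ℂ Φ y u) x = (fderiv ℂ (fderiv ℂ Φ) x).flip u := by
    intro u
    have := hd.hasFDerivAt.clm_apply (hasFDerivAt_const u x)
    rw [this.fderiv]
    simp
  rw [key, key]
  exact h2 w v

end DirectionalDerivatives

/-! ### Differential monomials of functions depending on a parameter -/

section Parameters

set_option linter.unusedSectionVars false

variable {σ : Type} [Fintype σ] [DecidableEq σ]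

/-- The operator `∂_p` in the second variable of a function on `ℂ × Sym`. -/
def partialDSnd (p : Sym2 σ) (Φ : ℂ × SymMat σ → ℂ) : ℂ × SymMat σ → ℂ :=
  fun x => (if p.IsDiag then 1 else 1 / 2) * fderiv ℂ Φ x (0, Pi.single p 1)

theorem analyticOnNhd_partialDSnd {Φ : ℂ × SymMat σ → ℂ} {U : Set (ℂ × SymMat σ)}
    (hΦ : AnalyticOnNhd ℂ Φ U) (p : Sym2 σ) : AnalyticOnNhd ℂ (partialDSnd p Φ) U := fun x hx =>
  analyticAt_const.mul (analyticOnNhd_fderiv_apply hΦ _ x hx)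

theorem analyticOnNhd_foldr_partialDSnd {Φ : ℂ × SymMat σ → ℂ} {U : Set (ℂ × SymMat σ)}
    (hΦ : AnalyticOnNhd ℂ Φ U) (l : List (Sym2 σ)) :
    AnalyticOnNhd ℂ (l.foldr partialDSnd Φ) U := by
  induction l with
  | nil => exact hΦ
  | cons p l ih => exact analyticOnNhd_partialDSnd ih p

theorem partialD_slice {Φ : ℂ × SymMat σ → ℂ} {τ : ℂ} {Z : SymMat σ}
    (hΦ : DifferentiableAt ℂ Φ (τ, Z)) (p : Sym2 σ) :
    partialD p (fun Z => Φ (τ, Z)) Z = partialDSnd p Φ (τ, Z) := by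
  have h1 : HasFDerivAt (fun Z : SymMat σ => (τ, Z)) (ContinuousLinearMap.inr ℂ ℂ (SymMat σ)) Z :=
    hasFDerivAt_prodMk_right τ Z
  have h2 := hΦ.hasFDerivAt.comp Z h1
  have h3 : fderiv ℂ (fun Z => Φ (τ, Z)) Z = _ := h2.fderiv
  simp [partialD, partialDSnd, h3]

theorem hasDerivAt_slice {Φ : ℂ × SymMat σ → ℂ} {τ : ℂ} {Z : SymMat σ}
    (hΦ : DifferentiableAt ℂ Φ (τ, Z)) :
    HasDerivAt (fun τ => Φ (τ, Z)) (fderiv ℂ Φ (τ, Z) (1, 0)) τ :=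
  hΦ.hasFDerivAt.comp_hasDerivAt τ ((hasDerivAt_id τ).prodMk (hasDerivAt_const τ Z))

theorem partialD_congr {F G : SymMat σ → ℂ} {U : Set (SymMat σ)} (hU : IsOpen U)
    (h : Set.EqOn F G U) (p : Sym2 σ) : Set.EqOn (partialD p F) (partialD p G) U := by
  intro Z hZ
  have : F =ᶠ[nhds Z] G := Filter.eventuallyEq_of_mem (hU.mem_nhds hZ) h
  simp only [partialD, this.fderiv_eq]

theorem monomialD_congr {F G : SymMat σ → ℂ} {U : Set (SymMat σ)} (hU : IsOpen U)
    (h : Set.EqOn F G U) (m : Sym2 σ →₀ ℕ) : Set.EqOn (monomialD m F) (monomialD m G) U := by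
  unfold monomialD
  induction (Finsupp.toMultiset m).toList with
  | nil => exact h
  | cons p l ih => exact partialD_congr hU ih p

theorem partialDSnd_congr {Φ Ψ : ℂ × SymMat σ → ℂ} {U : Set (ℂ × SymMat σ)} (hU : IsOpen U)
    (h : Set.EqOn Φ Ψ U) (p : Sym2 σ) : Set.EqOn (partialDSnd p Φ) (partialDSnd p Ψ) U := by
  intro Z hZ
  have : Φ =ᶠ[nhds Z] Ψ := Filter.eventuallyEq_of_mem (hU.mem_nhds hZ) h
  simp only [partialDSnd, this.fderiv_eq]

/-- Treating the parameter as one more variable turns interchange of derivatives into symmetry of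
second derivatives of a single analytic function; this lemma passes between the two viewpoints. -/
theorem foldr_partialD_slice {Φ : ℂ × SymMat σ → ℂ} {U : Set (ℂ × SymMat σ)} (hU : IsOpen U)
    (hΦ : AnalyticOnNhd ℂ Φ U) (l : List (Sym2 σ)) {τ : ℂ} {Z : SymMat σ} (h : (τ, Z) ∈ U) :
    l.foldr partialD (fun Z => Φ (τ, Z)) Z = l.foldr partialDSnd Φ (τ, Z) := by
  induction l generalizing Z with
  | nil => rfl
  | cons p l ih =>
    have hV : IsOpen {Z | (τ, Z) ∈ U} := hU.preimage (by fun_prop)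
    have h1 : Set.EqOn (l.foldr partialD fun Z => Φ (τ, Z))
        (fun Z => l.foldr partialDSnd Φ (τ, Z)) {Z | (τ, Z) ∈ U} := fun Z hZ => ih hZ
    rw [List.foldr_cons, partialD_congr hV h1 p h, List.foldr_cons]
    exact partialD_slice (analyticOnNhd_foldr_partialDSnd hΦ l _ h).differentiableAt p

theorem fderiv_partialDSnd {Φ : ℂ × SymMat σ → ℂ} {x : ℂ × SymMat σ} (hΦ : AnalyticAt ℂ Φ x)
    (p : Sym2 σ) (v : ℂ × SymMat σ) :
    fderiv ℂ (partialDSnd p Φ) x v = partialDSnd p (fun y => fderiv ℂ Φ y v) x := by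
  have hd : DifferentiableAt ℂ (fun y => fderiv ℂ Φ y (0, Pi.single p 1)) x :=
    (hΦ.fderiv.differentiableAt).clm_apply (differentiableAt_const _)
  unfold partialDSnd
  rw [fderiv_const_mul hd]
  simp only [smul_apply, smul_eq_mul]
  rw [fderiv_fderiv_comm hΦ]

theorem fderiv_foldr_partialDSnd {Φ : ℂ × SymMat σ → ℂ} {U : Set (ℂ × SymMat σ)} (hU : IsOpen U)
    (hΦ : AnalyticOnNhd ℂ Φ U) (l : List (Sym2 σ)) (v : ℂ × SymMat σ) :
    Set.EqOn (fun x => fderiv ℂ (l.foldr partialDSnd Φ) x v)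
      (l.foldr partialDSnd fun y => fderiv ℂ Φ y v) U := by
  induction l with
  | nil => exact fun _ _ => rfl
  | cons p l ih =>
    intro x hx
    simp only [List.foldr_cons]
    rw [fderiv_partialDSnd (analyticOnNhd_foldr_partialDSnd hΦ l x hx)]
    exact partialDSnd_congr hU ih p hx

/-- Differentiation with respect to a parameter commutes with `∂^m`. -/
theorem hasDerivAt_monomialD {Φ : ℂ × SymMat σ → ℂ} {U : Set (ℂ × SymMat σ)} (hU : IsOpen U)
    (hΦ : AnalyticOnNhd ℂ Φ U) (m : Sym2 σ →₀ ℕ) {τ : ℂ} {Z : SymMat σ} (h : (τ, Z) ∈ U) :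
    HasDerivAt (fun τ => monomialD m (fun Z => Φ (τ, Z)) Z)
      (monomialD m (fun Z => fderiv ℂ Φ (τ, Z) (1, 0)) Z) τ := by
  set l := (Finsupp.toMultiset m).toList with hl
  have h1 := hasDerivAt_slice (analyticOnNhd_foldr_partialDSnd hΦ l _ h).differentiableAt
  have h2 : fderiv ℂ (l.foldr partialDSnd Φ) (τ, Z) (1, 0) =
      monomialD m (fun Z => fderiv ℂ Φ (τ, Z) (1, 0)) Z := by
    rw [monomialD, ← hl]
    exact (fderiv_foldr_partialDSnd hU hΦ l (1, 0) h).trans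
      (foldr_partialD_slice hU (analyticOnNhd_fderiv_apply hΦ (1, 0)) l h).symm
  rw [← h2]
  refine h1.congr_of_eventuallyEq ?_
  have hV : IsOpen {τ | (τ, Z) ∈ U} := hU.preimage (by fun_prop)
  filter_upwards [hV.mem_nhds h] with τ' hτ'
  exact foldr_partialD_slice hU hΦ l hτ'

theorem continuousAt_monomialD {F : SymMat σ → ℂ} {U : Set (SymMat σ)} (hF : AnalyticOnNhd ℂ F U)
    (m : Sym2 σ →₀ ℕ) {Z : SymMat σ} (h : Z ∈ U) : ContinuousAt (monomialD m F) Z := by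
  suffices H : ∀ l : List (Sym2 σ), AnalyticOnNhd ℂ (l.foldr partialD F) U from
    (H _ Z h).continuousAt
  intro l
  induction l with
  | nil => exact hF
  | cons p l ih => exact fun x hx => analyticAt_const.mul (analyticOnNhd_fderiv_apply ih _ x hx)

theorem partialD_sum {ι : Type*} (s : Finset ι) (F : ι → SymMat σ → ℂ) (Z : SymMat σ)
    (hF : ∀ i ∈ s, DifferentiableAt ℂ (F i) Z) (p : Sym2 σ) :
    partialD p (fun Z => ∑ i ∈ s, F i Z) Z = ∑ i ∈ s, partialD p (F i) Z := by
  unfold partialD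
  rw [fderiv_fun_sum hF]
  simp [Finset.mul_sum]

theorem partialD_const_mul (c : ℂ) (F : SymMat σ → ℂ) (p : Sym2 σ) :
    partialD p (fun Z => c * F Z) = fun Z => c * partialD p F Z := by
  ext Z
  unfold partialD
  have : (fun Z => c * F Z) = c • F := rfl
  rw [this, fderiv_const_smul_field]
  simp only [Pi.smul_apply, smul_apply, smul_eq_mul]
  ring

theorem monomialD_sum {ι : Type*} (s : Finset ι) (F : ι → SymMat σ → ℂ)
    (hF : ∀ i ∈ s, AnalyticOnNhd ℂ (F i) Set.univ) (m : Sym2 σ →₀ ℕ) :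
    monomialD m (fun Z => ∑ i ∈ s, F i Z) = fun Z => ∑ i ∈ s, monomialD m (F i) Z := by
  unfold monomialD
  induction (Finsupp.toMultiset m).toList generalizing F with
  | nil => rfl
  | cons p l ih =>
    have hA : ∀ i ∈ s, AnalyticOnNhd ℂ (l.foldr partialD (F i)) Set.univ := by
      intro i hi
      clear ih
      induction l with
      | nil => exact hF i hi
      | cons p l ih => exact fun x hx => analyticAt_const.mul (analyticOnNhd_fderiv_apply ih _ x hx)
    simp only [List.foldr_cons]
    rw [ih F hF]
    ext Z
    exact partialD_sum s _ Z (fun i hi => (hA i hi Z trivial).differentiableAt) p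

theorem monomialD_const_mul (c : ℂ) (F : SymMat σ → ℂ) (m : Sym2 σ →₀ ℕ) :
    monomialD m (fun Z => c * F Z) = fun Z => c * monomialD m F Z := by
  unfold monomialD
  induction (Finsupp.toMultiset m).toList with
  | nil => rfl
  | cons p l ih =>
    rw [List.foldr_cons, ih, partialD_const_mul]
    rfl

end Parameters

/-! ### Exponentials as eigenfunctions of Q(∂) -/

section Exponentials

set_option linter.unusedSectionVars false

variable {σ : Type} [Fintype σ] [DecidableEq σ]

/-- `tr (T Z)` for symmetric matrices. -/
def traceForm (T Z : SymMat σ) : ℂ := ∑ i, ∑ j, T s(i, j) * Z s(i, j)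

theorem traceForm_eq_trace (T Z : SymMat σ) : traceForm T Z = (T.toMatrix * Z.toMatrix).trace := by
  simp [traceForm, Matrix.trace, Matrix.mul_apply, SymMat.toMatrix, Sym2.eq_swap]

theorem traceForm_add_smul (T Z H : SymMat σ) (t : ℂ) :
    traceForm T (Z + t • H) = traceForm T Z + t * traceForm T H := by
  simp only [traceForm, Pi.add_apply, Pi.smul_apply, smul_eq_mul, mul_add, Finset.sum_add_distrib,
    Finset.mul_sum]
  congr 1
  refine Finset.sum_congr rfl fun i _ => Finset.sum_congr rfl fun j _ => by ring

/-- An off-diagonal variable occurs twice in the trace; the factor 1/2 in ∂_{ij} compensates for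
this. -/
theorem traceForm_single (T : SymMat σ) (p : Sym2 σ) :
    (if p.IsDiag then 1 else 1 / 2) * traceForm T (Pi.single p 1) = T p := by
  induction p with
  | h a b =>
    have h1 : ∀ i j, T s(i, j) * (Pi.single s(a, b) 1 : SymMat σ) s(i, j) =
        if (i = a ∧ j = b) ∨ (i = b ∧ j = a) then T s(a, b) else 0 := by
      intro i j
      rw [Pi.single_apply]
      by_cases h : s(i, j) = s(a, b)
      · rw [if_pos h, if_pos (Sym2.eq_iff.1 h), h, mul_one]
      · rw [if_neg h, if_neg (fun h' => h (Sym2.eq_iff.2 h')), mul_zero]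
    simp only [traceForm, h1, Sym2.mk_isDiag_iff]
    by_cases hab : a = b
    · subst hab
      simp [ite_and]
    · have h2 : ∀ i j, (if (i = a ∧ j = b) ∨ (i = b ∧ j = a) then T s(a, b) else 0) =
          (if i = a then if j = b then T s(a, b) else 0 else 0) +
            (if i = b then if j = a then T s(a, b) else 0 else 0) := by
        intro i j
        by_cases hi : i = a <;> by_cases hj : j = b <;> by_cases hi' : i = b <;>
          by_cases hj' : j = a <;> simp_all
      simp [h2, Finset.sum_add_distrib, hab]
      ring

theorem analyticOnNhd_traceForm (T : SymMat σ) : AnalyticOnNhd ℂ (traceForm T) Set.univ := by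
  intro Z _
  unfold traceForm
  exact Finset.analyticAt_fun_sum _ fun i _ => Finset.analyticAt_fun_sum _ fun j _ =>
    analyticAt_const.mul
      ((ContinuousLinearMap.proj (R := ℂ) (φ := fun _ : Sym2 σ => ℂ) s(i, j)).analyticAt Z)

theorem partialD_exp (T : SymMat σ) (p : Sym2 σ) (c : ℂ) :
    partialD p (fun Z => c * Complex.exp (traceForm T Z)) =
      fun Z => T p * c * Complex.exp (traceForm T Z) := by
  ext Z
  have hd : DifferentiableAt ℂ (fun Z => c * Complex.exp (traceForm T Z)) Z :=
    ((analyticOnNhd_traceForm T Z trivial).differentiableAt.cexp).const_mul c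
  have h1 := hd.hasFDerivAt.comp_hasDerivAt_of_eq (0 : ℂ)
    (((hasDerivAt_id (0 : ℂ)).smul_const (Pi.single p 1 : SymMat σ)).const_add Z) (by simp)
  have h2 : HasDerivAt (fun t : ℂ => c * Complex.exp (traceForm T (Z + t • Pi.single p 1)))
      (c * (Complex.exp (traceForm T Z) * traceForm T (Pi.single p 1))) 0 := by
    simp only [traceForm_add_smul]
    have h3 : HasDerivAt (fun t : ℂ => traceForm T Z + t * traceForm T (Pi.single p 1))
      (traceForm T (Pi.single p 1)) 0 := by
      simpa using ((hasDerivAt_id (0 : ℂ)).mul_const (traceForm T (Pi.single p 1))).const_add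
        (traceForm T Z)
    simpa using h3.cexp.const_mul c
  have h4 := h1.unique h2
  simp only [one_smul] at h4
  unfold partialD
  rw [h4, ← traceForm_single T p]
  ring

theorem monomialD_exp (T : SymMat σ) (m : Sym2 σ →₀ ℕ) :
    monomialD m (fun Z => Complex.exp (traceForm T Z)) =
      fun Z => (m.prod fun p k => T p ^ k) * Complex.exp (traceForm T Z) := by
  have h : (m.prod fun p k => T p ^ k) = ((Finsupp.toMultiset m).toList.map T).prod := by
    rw [← Multiset.prod_coe, ← Multiset.map_coe, Multiset.coe_toList, Finsupp.toMultiset_map,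
      Finsupp.prod_toMultiset, Finsupp.prod_mapDomain_index] <;> simp [pow_add]
  rw [monomialD, h]
  induction (Finsupp.toMultiset m).toList with
  | nil => simp
  | cons p l ih => rw [List.foldr_cons, ih, partialD_exp, List.map_cons, List.prod_cons]

variable {W : Type*} [AddCommGroup W] [Module ℂ W]

/-- This is how values of Q are read off from the operator: testing covariance on exponentials
yields identities between values of Q. -/
theorem diffOp_exp (Q : SymPoly σ W) (T Z : SymMat σ) :
    Q.diffOp (fun Z => Complex.exp (traceForm T Z)) Z =
      Complex.exp (traceForm T Z) • Q.eval T := by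
  simp only [SymPoly.diffOp, SymPoly.eval, monomialD_exp, Finsupp.smul_sum, smul_smul, mul_comm]

theorem diffOp_congr (Q : SymPoly σ W) {F G : SymMat σ → ℂ} {U : Set (SymMat σ)} (hU : IsOpen U)
    (h : Set.EqOn F G U) {Z : SymMat σ} (hZ : Z ∈ U) : Q.diffOp F Z = Q.diffOp G Z :=
  Finsupp.sum_congr fun m _ => by rw [monomialD_congr hU h m hZ]

theorem diffOp_const_mul (Q : SymPoly σ W) (c : ℂ) (F : SymMat σ → ℂ) (Z : SymMat σ) :
    Q.diffOp (fun Z => c * F Z) Z = c • Q.diffOp F Z := by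
  simp only [SymPoly.diffOp, monomialD_const_mul, Finsupp.smul_sum, smul_smul]

theorem diffOp_sum (Q : SymPoly σ W) {ι : Type*} (s : Finset ι) (F : ι → SymMat σ → ℂ)
    (hF : ∀ i ∈ s, AnalyticOnNhd ℂ (F i) Set.univ) (Z : SymMat σ) :
    Q.diffOp (fun Z => ∑ i ∈ s, F i Z) Z = ∑ i ∈ s, Q.diffOp (F i) Z := by
  simp only [SymPoly.diffOp, monomialD_sum s F hF, Finsupp.sum, Finset.sum_smul]
  exact Finset.sum_comm

theorem apply_diffOp (Q : SymPoly σ W) (θ : Module.Dual ℂ W) (F : SymMat σ → ℂ) (Z : SymMat σ) :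
    θ (Q.diffOp F Z) = ∑ m ∈ Q.support, monomialD m F Z * θ (Q m) := by
  simp [SymPoly.diffOp, Finsupp.sum]

theorem hasDerivAt_diffOp (Q : SymPoly σ W) (θ : Module.Dual ℂ W) {Φ : ℂ × SymMat σ → ℂ}
    {U : Set (ℂ × SymMat σ)} (hU : IsOpen U) (hΦ : AnalyticOnNhd ℂ Φ U) {τ : ℂ} {Z : SymMat σ}
    (h : (τ, Z) ∈ U) :
    HasDerivAt (fun τ => θ (Q.diffOp (fun Z => Φ (τ, Z)) Z))
      (θ (Q.diffOp (fun Z => fderiv ℂ Φ (τ, Z) (1, 0)) Z)) τ := by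
  simp only [apply_diffOp]
  exact HasDerivAt.fun_sum fun m _ => (hasDerivAt_monomialD hU hΦ m h).mul_const _

theorem continuousAt_diffOp (Q : SymPoly σ W) (θ : Module.Dual ℂ W) {F : SymMat σ → ℂ}
    {U : Set (SymMat σ)} (hF : AnalyticOnNhd ℂ F U) {Z : SymMat σ} (h : Z ∈ U) :
    ContinuousAt (fun Z => θ (Q.diffOp F Z)) Z := by
  simp only [apply_diffOp]
  exact tendsto_finsetSum _ fun m _ => (continuousAt_monomialD hF m h).mul continuousAt_const

end Exponentials

/-! ### Gram matrices and translation of a row -/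

section Gram

set_option linter.unusedSectionVars false

variable {σ : Type} [Fintype σ] [DecidableEq σ] {κ : Type*} [Fintype κ] [DecidableEq κ]

/-- The symmetric matrix `Wᵗ W`. -/
def gram (W : Matrix κ σ ℂ) : SymMat σ := symOfMatrix (Wᵀ * W)

theorem gram_mk (W : Matrix κ σ ℂ) (i j : σ) : gram W s(i, j) = ∑ k, W k i * W k j := by
  simp only [gram, symOfMatrix, Sym2.lift_mk, Matrix.mul_apply, Matrix.transpose_apply]
  rw [← Finset.sum_add_distrib, Finset.sum_div]
  exact Finset.sum_congr rfl fun k _ => by ring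

/-- The bilinear form `xᵗ Z y` of a symmetric matrix. -/
def symForm (Z : SymMat σ) (x y : σ → ℂ) : ℂ := ∑ i, ∑ j, x i * Z s(i, j) * y j

theorem symForm_comm (Z : SymMat σ) (x y : σ → ℂ) : symForm Z x y = symForm Z y x := by
  unfold symForm
  rw [Finset.sum_comm]
  refine Finset.sum_congr rfl fun i _ => Finset.sum_congr rfl fun j _ => ?_
  rw [Sym2.eq_swap]; ring

theorem symForm_add_left (Z : SymMat σ) (x y z : σ → ℂ) :
    symForm Z (x + y) z = symForm Z x z + symForm Z y z := by
  simp only [symForm, Pi.add_apply, add_mul, Finset.sum_add_distrib]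

theorem symForm_smul_left (Z : SymMat σ) (t : ℂ) (x y : σ → ℂ) :
    symForm Z (t • x) y = t * symForm Z x y := by
  simp only [symForm, Pi.smul_apply, smul_eq_mul, Finset.mul_sum, mul_assoc]

theorem symForm_zero (x y : σ → ℂ) : symForm (0 : SymMat σ) x y = 0 := by simp [symForm]

theorem symForm_line (Z : SymMat σ) (t : ℂ) (x v : σ → ℂ) :
    symForm Z (x + t • v) (x + t • v) =
      symForm Z x x + 2 * t * symForm Z x v + t ^ 2 * symForm Z v v := by
  rw [symForm_add_left, symForm_smul_left, symForm_comm Z x, symForm_comm Z v, symForm_add_left,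
    symForm_add_left, symForm_smul_left, symForm_smul_left, symForm_comm Z v x]
  ring

theorem traceForm_gram (W : Matrix κ σ ℂ) (Z : SymMat σ) :
    traceForm (gram W) Z = ∑ k, symForm Z (W k) (W k) := by
  simp only [traceForm, gram_mk, symForm, Finset.sum_mul]
  conv_rhs => rw [Finset.sum_comm]
  refine Finset.sum_congr rfl fun i _ => ?_
  conv_rhs => rw [Finset.sum_comm]
  exact Finset.sum_congr rfl fun j _ => Finset.sum_congr rfl fun k _ => by ring

theorem analyticAt_symForm (x y : σ → ℂ) (Z : SymMat σ) :
    AnalyticAt ℂ (fun Z => symForm Z x y) Z := by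
  unfold symForm
  exact Finset.analyticAt_fun_sum _ fun i _ => Finset.analyticAt_fun_sum _ fun j _ =>
    (analyticAt_const.mul ((ContinuousLinearMap.proj (R := ℂ) (φ := fun _ : Sym2 σ => ℂ)
      s(i, j)).analyticAt Z)).mul analyticAt_const

/-- Translation of the row `k` by a multiple of `v`. -/
def shiftRow (W : Matrix κ σ ℂ) (k : κ) (v : σ → ℂ) (t : ℂ) : Matrix κ σ ℂ :=
  W.updateRow k (W k + t • v)

theorem traceForm_gram_shiftRow (W : Matrix κ σ ℂ) (k : κ) (v : σ → ℂ) (t : ℂ) (Z : SymMat σ) :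
    traceForm (gram (shiftRow W k v t)) Z =
      traceForm (gram W) Z + 2 * t * symForm Z (W k) v + t ^ 2 * symForm Z v v := by
  rw [traceForm_gram, traceForm_gram, ← Finset.add_sum_erase _ _ (Finset.mem_univ k),
    ← Finset.add_sum_erase (a := k) _ (fun k => symForm Z (W k) (W k)) (Finset.mem_univ k)]
  have h : ∀ k' ∈ Finset.univ.erase k, symForm Z (shiftRow W k v t k') (shiftRow W k v t k') =
      symForm Z (W k') (W k') := by
    intro k' hk'
    rw [shiftRow, Matrix.updateRow_ne (Finset.ne_of_mem_erase hk')]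
  rw [Finset.sum_congr rfl h, shiftRow, Matrix.updateRow_self, symForm_line]
  ring

end Gram

/-! ### Comparison of the unipotent action with the Laplacian -/

section Heat

set_option linter.unusedSectionVars false

variable {σ : Type} [Fintype σ] [DecidableEq σ] {κ : Type*} [Fintype κ] [DecidableEq κ]

/-- The function `exp (tr (WᵗW Z)) |_s (1 0; ε v vᵗ 1)` of `ε` and `Z`. -/
def unipSlash (s : ℂ) (W : Matrix κ σ ℂ) (v : σ → ℂ) (x : ℂ × SymMat σ) : ℂ :=
  Complex.exp (-s * Complex.log (1 + x.1 * symForm x.2 v v)) *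
    Complex.exp (traceForm (gram W) x.2 -
      x.1 * (∑ k, symForm x.2 (W k) v ^ 2) / (1 + x.1 * symForm x.2 v v))

/-- The domain of `unipSlash`. -/
def unipDomain (v : σ → ℂ) : Set (ℂ × SymMat σ) :=
  {x | 1 + x.1 * symForm x.2 v v ∈ Complex.slitPlane}

theorem analyticAt_denom (v : σ → ℂ) (x : ℂ × SymMat σ) :
    AnalyticAt ℂ (fun x : ℂ × SymMat σ => 1 + x.1 * symForm x.2 v v) x :=
  analyticAt_const.add (analyticAt_fst.mul ((analyticAt_symForm v v x.2).comp analyticAt_snd))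

theorem isOpen_unipDomain (v : σ → ℂ) : IsOpen (unipDomain (σ := σ) v) :=
  Complex.isOpen_slitPlane.preimage
    (continuous_iff_continuousAt.2 fun x => (analyticAt_denom v x).continuousAt)

theorem analyticOnNhd_unipSlash (s : ℂ) (W : Matrix κ σ ℂ) (v : σ → ℂ) :
    AnalyticOnNhd ℂ (unipSlash s W v) (unipDomain v) := by
  intro x hx
  refine ((analyticAt_const.mul ((analyticAt_denom v x).clog hx)).cexp).mul (AnalyticAt.cexp ?_)
  refine AnalyticAt.sub ((analyticOnNhd_traceForm _ x.2 trivial).comp analyticAt_snd) ?_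
  refine (analyticAt_fst.mul (Finset.analyticAt_fun_sum _ fun k _ => ?_)).div
    (analyticAt_denom v x) (Complex.slitPlane_ne_zero hx)
  exact ((analyticAt_symForm (W k) v x.2).comp analyticAt_snd).pow 2

theorem zero_mem_unipDomain (v : σ → ℂ) (Z : SymMat σ) : ((0 : ℂ), Z) ∈ unipDomain v := by
  simp [unipDomain]

theorem mem_unipDomain_zero (v : σ → ℂ) (ε : ℂ) : (ε, (0 : SymMat σ)) ∈ unipDomain v := by
  simp [unipDomain, symForm_zero]

/-- First-order term in ε: the automorphy factor contributes -s vᵗZv, and the displacement of Z by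
-ε Zv(Zv)ᵗ contributes the sum of squares. -/
theorem fderiv_unipSlash_zero (s : ℂ) (W : Matrix κ σ ℂ) (v : σ → ℂ) (Z : SymMat σ) :
    fderiv ℂ (unipSlash s W v) (0, Z) (1, 0) =
      (-s * symForm Z v v - ∑ k, symForm Z (W k) v ^ 2) *
        Complex.exp (traceForm (gram W) Z) := by
  have h1 := hasDerivAt_slice
    (analyticOnNhd_unipSlash s W v _ (zero_mem_unipDomain v Z)).differentiableAt
  refine h1.unique ?_
  set q := symForm Z v v
  set r := ∑ k, symForm Z (W k) v ^ 2
  have h2 : HasDerivAt (fun ε : ℂ => 1 + ε * q) q 0 := by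
    simpa using ((hasDerivAt_id (0 : ℂ)).mul_const q).const_add 1
  have h3 : HasDerivAt (fun ε : ℂ => -s * Complex.log (1 + ε * q)) (-s * q) 0 := by
    simpa using (h2.clog (by simp)).const_mul (-s)
  have h4 : HasDerivAt (fun ε : ℂ => traceForm (gram W) Z - ε * r / (1 + ε * q)) (-r) 0 := by
    have h5 : HasDerivAt (fun ε : ℂ => ε * r) r 0 := by
      simpa using (hasDerivAt_id (0 : ℂ)).mul_const r
    simpa using (h5.fun_div h2 (by simp)).const_sub (traceForm (gram W) Z)
  have h6 := h3.cexp.fun_mul h4.cexp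
  refine h6.congr_deriv ?_
  simp
  ring

/-- The function `exp (tr (W_tᵗ W_t Z))`, where the row `k` of `W` is translated by `t v`. -/
def expLine (W : Matrix κ σ ℂ) (k : κ) (v : σ → ℂ) (x : ℂ × SymMat σ) : ℂ :=
  Complex.exp (traceForm (gram W) x.2 + 2 * x.1 * symForm x.2 (W k) v +
    x.1 ^ 2 * symForm x.2 v v)

theorem analyticAt_expLine (W : Matrix κ σ ℂ) (k : κ) (v : σ → ℂ) (x : ℂ × SymMat σ) :
    AnalyticAt ℂ (expLine W k v) x := by
  refine AnalyticAt.cexp (AnalyticAt.add (AnalyticAt.add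
    ((analyticOnNhd_traceForm _ x.2 trivial).comp analyticAt_snd) ?_) ?_)
  · exact (analyticAt_const.mul analyticAt_fst).mul
      ((analyticAt_symForm (W k) v x.2).comp analyticAt_snd)
  · exact (analyticAt_fst.pow 2).mul ((analyticAt_symForm v v x.2).comp analyticAt_snd)

theorem hasDerivAt_expLine (W : Matrix κ σ ℂ) (k : κ) (v : σ → ℂ) (t : ℂ) (Z : SymMat σ) :
    HasDerivAt (fun t => expLine W k v (t, Z))
      ((2 * symForm Z (W k) v + 2 * t * symForm Z v v) * expLine W k v (t, Z)) t := by
  have h1 : HasDerivAt (fun t : ℂ => traceForm (gram W) Z + 2 * t * symForm Z (W k) v +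
      t ^ 2 * symForm Z v v) (2 * symForm Z (W k) v + 2 * t * symForm Z v v) t := by
    have h2 := ((hasDerivAt_id t).const_mul 2).mul_const (symForm Z (W k) v)
    have h3 := (hasDerivAt_pow 2 t).mul_const (symForm Z v v)
    simpa using (h2.const_add (traceForm (gram W) Z)).fun_add h3
  exact h1.cexp.congr_deriv (mul_comm _ _)

theorem fderiv_expLine (W : Matrix κ σ ℂ) (k : κ) (v : σ → ℂ) (x : ℂ × SymMat σ) :
    fderiv ℂ (expLine W k v) x (1, 0) =
      (2 * symForm x.2 (W k) v + 2 * x.1 * symForm x.2 v v) * expLine W k v x :=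
  (hasDerivAt_slice (analyticAt_expLine W k v x).differentiableAt).unique
    (hasDerivAt_expLine W k v x.1 x.2)

/-- Second-order term in t. It is built from the same quantities vᵗZv and (W_k Z v)² as the
first-order term in ε of the unipotent action, which makes the two comparable. -/
theorem fderiv_fderiv_expLine (W : Matrix κ σ ℂ) (k : κ) (v : σ → ℂ) (Z : SymMat σ) :
    fderiv ℂ (fun x => fderiv ℂ (expLine W k v) x (1, 0)) (0, Z) (1, 0) =
      (2 * symForm Z v v + 4 * symForm Z (W k) v ^ 2) * Complex.exp (traceForm (gram W) Z) := by
  have h1 := hasDerivAt_slice (analyticOnNhd_fderiv_apply (U := Set.univ)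
    (fun x _ => analyticAt_expLine W k v x) (1, 0) ((0 : ℂ), Z) trivial).differentiableAt
  refine h1.unique ?_
  simp only [fderiv_expLine]
  have h2 : HasDerivAt (fun t : ℂ => 2 * symForm Z (W k) v + 2 * t * symForm Z v v)
      (2 * symForm Z v v) 0 := by
    simpa using (((hasDerivAt_id (0 : ℂ)).const_mul 2).mul_const (symForm Z v v)).const_add
      (2 * symForm Z (W k) v)
  refine (h2.fun_mul (hasDerivAt_expLine W k v 0 Z)).congr_deriv ?_
  simp [expLine]
  ring

variable {E : Type*} [AddCommGroup E] [Module ℂ E]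

/-- If `Q(∂)` at `0` is invariant under the weight `|κ| / 2` action of `(1 0; ε v vᵗ 1)`, then
`Q(WᵗW)` is harmonic in the direction `v`. -/
theorem sum_deriv_deriv_eval_gram (Q : SymPoly σ E) (θ : Module.Dual ℂ E) (W : Matrix κ σ ℂ)
    (v : σ → ℂ) (h : ∀ ε : ℝ, Q.eval (gram W) =
      Q.diffOp (fun Z => unipSlash ((Fintype.card κ : ℂ) / 2) W v (ε, Z)) 0) :
    ∑ k, deriv (deriv fun t : ℂ => θ (Q.eval (gram (shiftRow W k v t)))) 0 = 0 := by
  have h1 : ∀ k, deriv (deriv fun t : ℂ => θ (Q.eval (gram (shiftRow W k v t)))) 0 =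
      θ (Q.diffOp (fun Z => (2 * symForm Z v v + 4 * symForm Z (W k) v ^ 2) *
        Complex.exp (traceForm (gram W) Z)) 0) := by
    intro k
    have hA : AnalyticOnNhd ℂ (expLine W k v) Set.univ := fun x _ => analyticAt_expLine W k v x
    have e1 : (fun t : ℂ => θ (Q.eval (gram (shiftRow W k v t)))) =
        fun t => θ (Q.diffOp (fun Z => expLine W k v (t, Z)) 0) := by
      ext t
      have := diffOp_exp Q (gram (shiftRow W k v t)) 0
      simp only [traceForm_gram_shiftRow] at this
      rw [show (fun Z => expLine W k v (t, Z)) = fun Z => Complex.exp (traceForm (gram W) Z +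
        2 * t * symForm Z (W k) v + t ^ 2 * symForm Z v v) from rfl, this]
      simp [symForm_zero, traceForm]
    have e2 : deriv (fun t : ℂ => θ (Q.eval (gram (shiftRow W k v t)))) = fun t =>
        θ (Q.diffOp (fun Z => fderiv ℂ (expLine W k v) (t, Z) (1, 0)) 0) := by
      rw [e1]
      ext t
      exact (hasDerivAt_diffOp Q θ isOpen_univ hA (Set.mem_univ (t, 0))).deriv
    rw [e2]
    have e3 := (hasDerivAt_diffOp Q θ isOpen_univ (analyticOnNhd_fderiv_apply hA (1, 0))
      (Set.mem_univ ((0 : ℂ), (0 : SymMat σ)))).deriv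
    simp only [fderiv_fderiv_expLine] at e3
    exact e3
  have h2 : HasDerivAt (fun ε : ℂ =>
      θ (Q.diffOp (fun Z => unipSlash ((Fintype.card κ : ℂ) / 2) W v (ε, Z)) 0))
      (θ (Q.diffOp (fun Z => (-((Fintype.card κ : ℂ) / 2) * symForm Z v v -
        ∑ k, symForm Z (W k) v ^ 2) * Complex.exp (traceForm (gram W) Z)) 0)) 0 := by
    have := hasDerivAt_diffOp Q θ (isOpen_unipDomain v)
      (analyticOnNhd_unipSlash ((Fintype.card κ : ℂ) / 2) W v) (zero_mem_unipDomain v 0)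
    simpa only [fderiv_unipSlash_zero] using this
  -- Invariance is available for real ε only, so the complex derivative is compared with that of its
  -- restriction to the real line, a constant.
  have h3 : HasDerivAt (fun ε : ℝ =>
      θ (Q.diffOp (fun Z => unipSlash ((Fintype.card κ : ℂ) / 2) W v ((ε : ℂ), Z)) 0)) 0 0 := by
    simp only [← h]
    exact hasDerivAt_const _ _
  have h4 := (HasDerivAt.comp_ofReal (z := 0) (by rw [Complex.ofReal_zero]; exact h2)).unique h3
  simp only [h1]
  rw [← map_sum, ← diffOp_sum]
  -- Summing over the |κ| rows gives 2|κ| vᵗZv + 4∑(W_k Z v)². This is a multiple of the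
  -- ε-derivative exactly because the weight is |κ|/2; the multiple is -4.
  · have e : (fun Z => ∑ k, (2 * symForm Z v v + 4 * symForm Z (W k) v ^ 2) *
        Complex.exp (traceForm (gram W) Z)) = fun Z => (-4) * ((-((Fintype.card κ : ℂ) / 2) *
          symForm Z v v - ∑ k, symForm Z (W k) v ^ 2) * Complex.exp (traceForm (gram W) Z)) := by
      ext Z
      rw [← Finset.sum_mul, Finset.sum_add_distrib, Finset.sum_const, Finset.card_univ,
        nsmul_eq_mul, ← Finset.mul_sum]
      ring
    rw [e, diffOp_const_mul, map_smul, h4, smul_zero]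
  · intro k _ Z _
    refine AnalyticAt.mul (AnalyticAt.add ?_ ?_) (analyticOnNhd_traceForm _ Z trivial).cexp
    · exact analyticAt_const.mul (analyticAt_symForm v v Z)
    · exact analyticAt_const.mul ((analyticAt_symForm (W k) v Z).pow 2)

end Heat

/-! ### Lower unipotent symplectic matrices and the limit Z → 0 -/

section Unipotent

set_option linter.unusedSectionVars false

variable {σ : Type} [Fintype σ] [DecidableEq σ]

theorem toMatrix_transpose (Z : SymMat σ) : Z.toMatrixᵀ = Z.toMatrix := by
  ext i j
  simp [SymMat.toMatrix, Sym2.eq_swap]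

theorem toMatrix_symOfMatrix {M : Matrix σ σ ℂ} (h : Mᵀ = M) : (symOfMatrix M).toMatrix = M := by
  ext i j
  have : M j i = M i j := congrFun (congrFun h i) j
  simp [SymMat.toMatrix, symOfMatrix, this]

theorem symForm_eq_dotProduct (Z : SymMat σ) (x y : σ → ℂ) :
    symForm Z x y = x ⬝ᵥ (Z.toMatrix *ᵥ y) := by
  simp [symForm, dotProduct, Matrix.mulVec, SymMat.toMatrix, Finset.mul_sum, mul_assoc]

/-- The symplectic matrix `(1 0; ε v vᵗ 1)`. -/
def lowerUnip (ε : ℝ) (v : σ → ℝ) : Matrix (σ ⊕ σ) (σ ⊕ σ) ℝ :=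
  Matrix.fromBlocks 1 0 (ε • Matrix.vecMulVec v v) 1

theorem lowerUnip_mem (ε : ℝ) (v : σ → ℝ) : lowerUnip ε v ∈ Matrix.symplecticGroup σ ℝ := by
  rw [lowerUnip, SymplecticGroup.fromBlocks_mem_iff]
  simp [Matrix.transpose_smul, Matrix.transpose_vecMulVec]

theorem upDown_lowerUnip {n : ℕ} (ε : ℝ) (v : Fin n → ℝ) :
    upDown (lowerUnip ε v) (lowerUnip ε 0) = lowerUnip ε (Sum.elim v 0) := by
  simp only [upDown, lowerUnip, Matrix.toBlocks_fromBlocks₁₁, Matrix.toBlocks_fromBlocks₁₂,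
    Matrix.toBlocks_fromBlocks₂₁, Matrix.toBlocks_fromBlocks₂₂, Matrix.fromBlocks_one]
  congr 1
  · ext (i | i) (j | j) <;> simp
  · ext (i | i) (j | j) <;> simp [Matrix.vecMulVec_apply]

/-- The factor `det (C Z + D) = 1 + ε vᵗ Z v`. -/
def unipDenom (ε : ℝ) (v : σ → ℝ) (Z : SymMat σ) : ℂ :=
  1 + ε * symForm Z (fun i => (v i : ℂ)) fun i => (v i : ℂ)

theorem autDenom_lowerUnip (ε : ℝ) (v : σ → ℝ) (Z : SymMat σ) :
    autDenom (lowerUnip ε v) Z = 1 + Matrix.vecMulVec ((ε : ℂ) • fun i => (v i : ℂ))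
      (Z.toMatrix *ᵥ fun i => (v i : ℂ)) := by
  have h : ((ε • Matrix.vecMulVec v v).map Complex.ofReal) =
      Matrix.vecMulVec ((ε : ℂ) • fun i => (v i : ℂ)) fun i => (v i : ℂ) := by
    ext i j
    simp [Matrix.vecMulVec_apply, mul_assoc]
  simp only [autDenom, lowerUnip, Matrix.toBlocks_fromBlocks₂₁, Matrix.toBlocks_fromBlocks₂₂]
  rw [h, Matrix.vecMulVec_mul, ← Matrix.mulVec_transpose, toMatrix_transpose, add_comm]
  congr 1
  ext i j
  simp [Matrix.one_apply, apply_ite Complex.ofReal]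

theorem det_autDenom_lowerUnip (ε : ℝ) (v : σ → ℝ) (Z : SymMat σ) :
    (autDenom (lowerUnip ε v) Z).det = unipDenom ε v Z := by
  rw [autDenom_lowerUnip, Matrix.vecMulVec_eq Unit,
    Matrix.det_one_add_replicateCol_mul_replicateRow, unipDenom, symForm_eq_dotProduct,
    dotProduct_smul, smul_eq_mul, dotProduct_comm]

/-- The Sherman–Morrison formula: CZ + D is a rank-one perturbation of the identity. -/
theorem inv_autDenom_lowerUnip (ε : ℝ) (v : σ → ℝ) (Z : SymMat σ) (h : unipDenom ε v Z ≠ 0) :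
    (autDenom (lowerUnip ε v) Z)⁻¹ = 1 - (ε / unipDenom ε v Z) •
      Matrix.vecMulVec (fun i => (v i : ℂ)) (Z.toMatrix *ᵥ fun i => (v i : ℂ)) := by
  apply Matrix.inv_eq_right_inv
  rw [autDenom_lowerUnip, Matrix.smul_vecMulVec]
  set V : σ → ℂ := fun i => (v i : ℂ)
  set w := Z.toMatrix *ᵥ V
  have ha : unipDenom ε v Z = 1 + ε * (w ⬝ᵥ V) := by
    rw [unipDenom, symForm_eq_dotProduct, dotProduct_comm]
  simp only [add_mul, mul_sub, one_mul, mul_one, Matrix.smul_mul, Matrix.mul_smul,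
    Matrix.vecMulVec_mul_vecMulVec, Matrix.vecMulVec_smul]
  have : (ε : ℂ) - ε / unipDenom ε v Z - ε * (ε / unipDenom ε v Z) * (w ⬝ᵥ V) = 0 := by
    field_simp
    rw [ha]; ring
  have h2 : (1 : Matrix σ σ ℂ) + (ε : ℂ) • Matrix.vecMulVec V w -
      ((ε / unipDenom ε v Z) • Matrix.vecMulVec V w +
        (ε / unipDenom ε v Z) • (ε : ℂ) • (w ⬝ᵥ V) • Matrix.vecMulVec V w) =
      1 + ((ε : ℂ) - ε / unipDenom ε v Z - ε * (ε / unipDenom ε v Z) * (w ⬝ᵥ V)) •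
        Matrix.vecMulVec V w := by
    module
  rw [this, zero_smul, add_zero] at h2
  exact h2

theorem moebius_lowerUnip (ε : ℝ) (v : σ → ℝ) (Z : SymMat σ) (h : unipDenom ε v Z ≠ 0) (i j : σ) :
    moebius (lowerUnip ε v) Z s(i, j) = Z s(i, j) - ε / unipDenom ε v Z *
      ((Z.toMatrix *ᵥ fun i => (v i : ℂ)) i * (Z.toMatrix *ᵥ fun i => (v i : ℂ)) j) := by
  have h1 : moebius (lowerUnip ε v) Z = symOfMatrix (Z.toMatrix * (autDenom (lowerUnip ε v) Z)⁻¹) := by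
    simp [moebius, lowerUnip]
  rw [h1, inv_autDenom_lowerUnip ε v Z h, mul_sub, mul_one, Matrix.mul_smul, Matrix.mul_vecMulVec]
  simp only [symOfMatrix, Sym2.lift_mk, Matrix.sub_apply, Matrix.smul_apply, Matrix.vecMulVec_apply,
    smul_eq_mul, SymMat.toMatrix, Matrix.of_apply, Sym2.eq_swap (a := j) (b := i)]
  ring

/-- M⟨Z⟩ differs from Z by a multiple of the rank-one matrix Zv(Zv)ᵗ, and pairing that matrix with
WᵗW gives a sum of squares over the rows. -/
theorem traceForm_gram_moebius {κ : Type*} [Fintype κ] [DecidableEq κ] (W : Matrix κ σ ℂ) (ε : ℝ) (v : σ → ℝ)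
    (Z : SymMat σ) (h : unipDenom ε v Z ≠ 0) :
    traceForm (gram W) (moebius (lowerUnip ε v) Z) = traceForm (gram W) Z -
      ε * (∑ k, symForm Z (W k) (fun i => (v i : ℂ)) ^ 2) / unipDenom ε v Z := by
  rw [traceForm_gram, traceForm_gram, Finset.mul_sum, Finset.sum_div, ← Finset.sum_sub_distrib]
  refine Finset.sum_congr rfl fun k _ => ?_
  rw [symForm_eq_dotProduct Z (W k) fun i => (v i : ℂ)]
  set w := Z.toMatrix *ᵥ fun i => (v i : ℂ)
  have h1 : (W k ⬝ᵥ w) ^ 2 = ∑ i, ∑ j, W k i * w i * (W k j * w j) := by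
    rw [sq, dotProduct, Finset.sum_mul_sum]
  rw [h1]
  simp only [symForm, moebius_lowerUnip ε v Z h, Finset.mul_sum, Finset.sum_div,
    ← Finset.sum_sub_distrib]
  refine Finset.sum_congr rfl fun i _ => Finset.sum_congr rfl fun j _ => ?_
  ring

/-- The imaginary part is ε vᵗ(Im Z)v, non-zero unless the denominator is identically 1. So the
principal logarithm is a branch on the whole half space. -/
theorem unipDenom_mem_slitPlane (ε : ℝ) (v : σ → ℝ) {Z : SymMat σ} (hZ : Z ∈ siegelHalfSpace σ) :
    unipDenom ε v Z ∈ Complex.slitPlane := by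
  have him : (symForm Z (fun i => (v i : ℂ)) fun i => (v i : ℂ)).im =
      v ⬝ᵥ ((Z.toMatrix.map Complex.im) *ᵥ v) := by
    simp [symForm, dotProduct, Matrix.mulVec, SymMat.toMatrix, Finset.mul_sum, mul_assoc]
  by_cases h : ε = 0 ∨ v = 0
  · have : unipDenom ε v Z = 1 := by
      rcases h with rfl | rfl <;> simp [unipDenom, symForm]
    rw [this]
    exact Complex.one_mem_slitPlane
  · rw [not_or] at h
    have hpos := Matrix.PosDef.dotProduct_mulVec_pos (M := Z.toMatrix.map Complex.im) hZ h.2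
    rw [star_trivial, ← him] at hpos
    refine Complex.mem_slitPlane_iff.2 (Or.inr ?_)
    simp only [unipDenom, Complex.add_im, Complex.one_im,
      Complex.im_ofReal_mul, zero_add]
    exact mul_ne_zero h.1 hpos.ne'

/-- The explicit branch of `log det (C Z + D)` for `(1 0; ε v vᵗ 1)`. -/
theorem isLogDet_lowerUnip (ε : ℝ) (v : σ → ℝ) :
    IsLogDet (lowerUnip ε v) fun Z => Complex.log (unipDenom ε v Z) := by
  refine ⟨fun Z hZ => DifferentiableAt.differentiableWithinAt ?_, fun Z hZ => ?_⟩
  · refine DifferentiableAt.clog ?_ (unipDenom_mem_slitPlane ε v hZ)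
    unfold unipDenom
    exact (analyticAt_const.add (analyticAt_const.mul
      (analyticAt_symForm _ _ Z))).differentiableAt
  · rw [Complex.exp_log (Complex.slitPlane_ne_zero (unipDenom_mem_slitPlane ε v hZ)),
      det_autDenom_lowerUnip]

theorem slash_lowerUnip {κ : Type*} [Fintype κ] [DecidableEq κ] (s : ℂ) (W : Matrix κ σ ℂ)
    (ε : ℝ) (v : σ → ℝ) {Z : SymMat σ} (h : unipDenom ε v Z ∈ Complex.slitPlane) :
    slash s (lowerUnip ε v) (fun Z => Complex.log (unipDenom ε v Z))
      (fun Z => Complex.exp (traceForm (gram W) Z)) Z =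
      unipSlash s W (fun i => (v i : ℂ)) (ε, Z) := by
  simp only [slash, unipSlash]
  rw [traceForm_gram_moebius W ε v Z (Complex.slitPlane_ne_zero h)]
  rfl

/-- The point `i y` of the Siegel upper half space. -/
def scalarPoint (σ : Type) [DecidableEq σ] (y : ℝ) : SymMat σ :=
  symOfMatrix ((Complex.I * y) • (1 : Matrix σ σ ℂ))

theorem toMatrix_scalarPoint (y : ℝ) :
    (scalarPoint σ y).toMatrix = (Complex.I * y) • (1 : Matrix σ σ ℂ) :=
  toMatrix_symOfMatrix (by simp)

theorem scalarPoint_mem {y : ℝ} (hy : 0 < y) : scalarPoint σ y ∈ siegelHalfSpace σ := by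
  have h : (scalarPoint σ y).toMatrix.map Complex.im = Matrix.diagonal fun _ => y := by
    rw [toMatrix_scalarPoint]
    ext i j
    by_cases hij : i = j
    · subst hij; simp
    · simp [hij]
  simp only [siegelHalfSpace, Set.mem_ofPred_eq, h]
  exact Matrix.PosDef.diagonal fun _ => hy

theorem blockDiag_scalarPoint {n : ℕ} (y : ℝ) :
    blockDiag (scalarPoint (Fin n) y) (scalarPoint (Fin n) y) =
      scalarPoint (Fin n ⊕ Fin n) y := by
  rw [blockDiag, toMatrix_scalarPoint, scalarPoint]
  congr 1
  rw [← Matrix.fromBlocks_one, Matrix.fromBlocks_smul]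
  simp

theorem tendsto_scalarPoint : Filter.Tendsto (scalarPoint σ) (nhds 0) (nhds 0) := by
  rw [tendsto_pi_nhds]
  intro p
  induction p with
  | h i j =>
    have : (fun y => scalarPoint σ y s(i, j)) =
        fun y : ℝ => Complex.I * y * (1 : Matrix σ σ ℂ) i j := by
      ext y
      have := congrFun (congrFun (toMatrix_scalarPoint (σ := σ) y) i) j
      simpa [SymMat.toMatrix] using this
    rw [this]
    have hc : Continuous fun y : ℝ => Complex.I * y * (1 : Matrix σ σ ℂ) i j := by fun_prop
    simpa using hc.tendsto 0

theorem tendsto_unipDenom (ε : ℝ) (v : σ → ℝ) :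
    Filter.Tendsto (fun y => unipDenom ε v (scalarPoint σ y)) (nhds 0) (nhds 1) := by
  have h : ContinuousAt (unipDenom ε v) 0 :=
    (analyticAt_const.add (analyticAt_const.mul (analyticAt_symForm _ _ 0))).continuousAt
  have := h.tendsto.comp (tendsto_scalarPoint (σ := σ))
  simpa [unipDenom, symForm_zero, Function.comp_def] using this

theorem tendsto_mulVec_scalarPoint (v : σ → ℝ) (i : σ) :
    Filter.Tendsto (fun y => ((scalarPoint σ y).toMatrix *ᵥ fun i => (v i : ℂ)) i)
      (nhds 0) (nhds 0) := by
  simp only [toMatrix_scalarPoint, Matrix.smul_mulVec, Matrix.one_mulVec, Pi.smul_apply,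
    smul_eq_mul]
  have hc : Continuous fun y : ℝ => Complex.I * y * (v i : ℂ) := by fun_prop
  simpa using hc.tendsto 0

theorem tendsto_inv_autDenom (ε : ℝ) (v : σ → ℝ) (i j : σ) :
    Filter.Tendsto (fun y => (autDenom (lowerUnip ε v) (scalarPoint σ y))⁻¹ i j)
      (nhdsWithin 0 (Set.Ioi 0)) (nhds ((1 : Matrix σ σ ℂ) i j)) := by
  have h1 : Filter.Tendsto (fun y => (1 : Matrix σ σ ℂ) i j - (ε / unipDenom ε v (scalarPoint σ y)) *
      (v i * ((scalarPoint σ y).toMatrix *ᵥ fun i => (v i : ℂ)) j)) (nhds 0)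
      (nhds ((1 : Matrix σ σ ℂ) i j - (ε / 1) * (v i * 0))) :=
    tendsto_const_nhds.sub ((tendsto_const_nhds.div (tendsto_unipDenom ε v) one_ne_zero).mul
      (tendsto_const_nhds.mul (tendsto_mulVec_scalarPoint v j)))
  simp only [mul_zero, sub_zero] at h1
  refine (h1.mono_left nhdsWithin_le_nhds).congr' ?_
  filter_upwards [self_mem_nhdsWithin] with y hy
  rw [inv_autDenom_lowerUnip ε v _
    (Complex.slitPlane_ne_zero (unipDenom_mem_slitPlane ε v (scalarPoint_mem hy)))]
  simp [Matrix.vecMulVec_apply]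

theorem tendsto_moebius_scalarPoint (ε : ℝ) (v : σ → ℝ) :
    Filter.Tendsto (fun y => moebius (lowerUnip ε v) (scalarPoint σ y))
      (nhdsWithin 0 (Set.Ioi 0)) (nhds 0) := by
  rw [tendsto_pi_nhds]
  intro p
  induction p with
  | h i j =>
    have h0 : Filter.Tendsto (fun y => scalarPoint σ y s(i, j)) (nhds 0) (nhds 0) :=
      tendsto_pi_nhds.1 tendsto_scalarPoint s(i, j)
    have h1 := h0.sub ((tendsto_const_nhds (x := (ε : ℂ)).div (tendsto_unipDenom ε v)
      one_ne_zero).mul ((tendsto_mulVec_scalarPoint v i).mul (tendsto_mulVec_scalarPoint v j)))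
    simp only [mul_zero, sub_zero] at h1
    refine (h1.mono_left nhdsWithin_le_nhds).congr' ?_
    filter_upwards [self_mem_nhdsWithin] with y hy
    exact (moebius_lowerUnip ε v _
      (Complex.slitPlane_ne_zero (unipDenom_mem_slitPlane ε v (scalarPoint_mem hy))) i j).symm

end Unipotent

/-! ### Consequences of covariance: harmonicity and Levi equivariance -/

section Covariance

variable {n : ℕ} {V : Type*} [AddCommGroup V] [Module ℂ V]
  {ρ : Representation ℂ (GL (Fin n) ℂ) V}

/-- V carries no topology, so limits are taken after applying a functional; polynomial matrix
coefficients are continuous. -/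
theorem tendsto_map_rep (hpoly : IsPolynomialRep ρ) {ι : Type*} {f : Filter ι}
    (g : ι → GL (Fin n) ℂ)
    (hg : ∀ i j, Filter.Tendsto (fun y => (g y : Matrix (Fin n) (Fin n) ℂ) i j) f
      (nhds ((1 : Matrix (Fin n) (Fin n) ℂ) i j)))
    (θ : Module.Dual ℂ (V ⊗[ℂ] V)) (x : V ⊗[ℂ] V) :
    Filter.Tendsto (fun y => θ (TensorProduct.map (ρ (g y)) (ρ 1) x)) f (nhds (θ x)) := by
  induction x using TensorProduct.induction_on with
  | zero => simpa using tendsto_const_nhds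
  | add x y hx hy => simpa only [map_add] using hx.add hy
  | tmul v w =>
    obtain ⟨p, hp⟩ := hpoly (θ ∘ₗ (TensorProduct.mk ℂ V V).flip w) v
    have h1 : ∀ g : GL (Fin n) ℂ, θ (TensorProduct.map (ρ g) (ρ 1) (v ⊗ₜ w)) =
        MvPolynomial.eval (fun ij => (g : Matrix (Fin n) (Fin n) ℂ) ij.1 ij.2) p := by
      intro g
      rw [← hp]
      simp
    have h2 : θ (v ⊗ₜ w) = MvPolynomial.eval
        (fun ij => (1 : Matrix (Fin n) (Fin n) ℂ) ij.1 ij.2) p := by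
      have := h1 1
      simpa using this
    simp only [h1, h2]
    exact (p.continuous_eval.tendsto _).comp (tendsto_pi_nhds.2 fun ij => hg ij.1 ij.2)

/-- Covariance is applied to exp(tr(WᵗWZ)) at z = w = iy, and y tends to 0 from above. At the
boundary point 0 all automorphy factors and exponentials become 1, so the left side tends to Q(WᵗW).
-/
theorem eval_gram_eq_diffOp_unipSlash (hpoly : IsPolynomialRep ρ) {s : ℂ}
    {Q : SymPoly (Fin n ⊕ Fin n) (V ⊗[ℂ] V)} (hQ : IsCovariant ρ s Q)
    {κ : Type*} [Fintype κ] [DecidableEq κ] (W : Matrix κ (Fin n ⊕ Fin n) ℂ) (ε : ℝ)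
    (v : Fin n → ℝ) :
    Q.eval (gram W) = Q.diffOp
      (fun Z => unipSlash s W (fun i => ((Sum.elim v 0 i : ℝ) : ℂ)) (ε, Z)) 0 := by
  rw [← sub_eq_zero, ← Module.forall_dual_apply_eq_zero_iff ℂ]
  intro θ
  rw [map_sub, sub_eq_zero]
  set v' : Fin n ⊕ Fin n → ℝ := Sum.elim v 0 with hv'
  set F := fun Z => unipSlash s W (fun i => (v' i : ℂ)) (ε, Z) with hF
  -- Unlike the half space, U contains the limit point 0, so the right side is continuous there.
  let U : Set (SymMat (Fin n ⊕ Fin n)) := {Z | unipDenom ε v' Z ∈ Complex.slitPlane}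
  have hU : IsOpen U :=
    (isOpen_unipDomain fun i => (v' i : ℂ)).preimage (by fun_prop : Continuous fun Z => ((ε : ℂ), Z))
  have hFU : AnalyticOnNhd ℂ F U := fun Z hZ =>
    (analyticOnNhd_unipSlash s W (fun i => (v' i : ℂ)) (ε, Z) hZ).comp
      (analyticAt_const.prod analyticAt_id)
  have hy : Filter.Tendsto (fun y : ℝ => scalarPoint (Fin n ⊕ Fin n) y)
      (nhdsWithin 0 (Set.Ioi 0)) (nhds 0) := tendsto_scalarPoint.mono_left nhdsWithin_le_nhds
  have hR : Filter.Tendsto (fun y : ℝ => θ (Q.diffOp F (scalarPoint (Fin n ⊕ Fin n) y)))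
      (nhdsWithin 0 (Set.Ioi 0)) (nhds (θ (Q.diffOp F 0))) :=
    (continuousAt_diffOp Q θ hFU (mem_unipDomain_zero (fun i => (v' i : ℂ)) ε)).tendsto.comp hy
  let g : ℝ → GL (Fin n) ℂ := fun y =>
    if h : (autDenom (lowerUnip ε v) (scalarPoint (Fin n) y)).det ≠ 0 then
      Matrix.GeneralLinearGroup.mkOfDetNeZero _ h else 1
  have hdet : ∀ y > 0, (autDenom (lowerUnip ε v) (scalarPoint (Fin n) y)).det ≠ 0 := by
    intro y hy
    rw [det_autDenom_lowerUnip]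
    exact Complex.slitPlane_ne_zero (unipDenom_mem_slitPlane ε v (scalarPoint_mem hy))
  have hg : ∀ y > 0, (g y : Matrix (Fin n) (Fin n) ℂ) =
      autDenom (lowerUnip ε v) (scalarPoint (Fin n) y) := by
    intro y hy
    simp only [g]
    rw [dif_pos (hdet y hy)]
    rfl
  have hL : Filter.Tendsto (fun y : ℝ =>
      Complex.exp (-s * Complex.log (unipDenom ε v' (scalarPoint (Fin n ⊕ Fin n) y))) *
        (Complex.exp (traceForm (gram W)
          (blockDiag (moebius (lowerUnip ε v) (scalarPoint (Fin n) y))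
            (moebius (lowerUnip ε 0) (scalarPoint (Fin n) y)))) *
          θ (TensorProduct.map (ρ (g y)⁻¹) (ρ 1) (Q.eval (gram W)))))
      (nhdsWithin 0 (Set.Ioi 0)) (nhds (θ (Q.eval (gram W)))) := by
    have h1 : Filter.Tendsto (fun y : ℝ =>
        Complex.exp (-s * Complex.log (unipDenom ε v' (scalarPoint (Fin n ⊕ Fin n) y))))
        (nhdsWithin 0 (Set.Ioi 0)) (nhds 1) := by
      have h2 := ((tendsto_unipDenom ε v').clog Complex.one_mem_slitPlane).const_mul (-s)
      simpa using (h2.cexp).mono_left nhdsWithin_le_nhds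
    have h3 : Filter.Tendsto (fun y : ℝ => Complex.exp (traceForm (gram W)
        (blockDiag (moebius (lowerUnip ε v) (scalarPoint (Fin n) y))
          (moebius (lowerUnip ε 0) (scalarPoint (Fin n) y)))))
        (nhdsWithin 0 (Set.Ioi 0)) (nhds 1) := by
      have hz : ∀ v : Fin n → ℝ, ∀ p, Filter.Tendsto
          (fun y => moebius (lowerUnip ε v) (scalarPoint (Fin n) y) p)
          (nhdsWithin 0 (Set.Ioi 0)) (nhds 0) :=
        fun v => tendsto_pi_nhds.1 (tendsto_moebius_scalarPoint ε v)
      have h4 : Filter.Tendsto (fun y => blockDiag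
          (moebius (lowerUnip ε v) (scalarPoint (Fin n) y))
          (moebius (lowerUnip ε 0) (scalarPoint (Fin n) y)))
          (nhdsWithin 0 (Set.Ioi 0)) (nhds 0) := by
        rw [tendsto_pi_nhds]
        intro p
        induction p with
        | h i j =>
          rcases i with i | i <;> rcases j with j | j <;>
            simp only [blockDiag, symOfMatrix, Sym2.lift_mk, Matrix.fromBlocks_apply₁₁,
              Matrix.fromBlocks_apply₁₂, Matrix.fromBlocks_apply₂₁, Matrix.fromBlocks_apply₂₂,
              SymMat.toMatrix, Matrix.of_apply, Matrix.zero_apply, add_zero, zero_div, Pi.zero_apply]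
          · simpa using ((hz v s(i, j)).add (hz v s(j, i))).div_const 2
          · exact tendsto_const_nhds
          · exact tendsto_const_nhds
          · simpa using ((hz 0 s(i, j)).add (hz 0 s(j, i))).div_const 2
      have h5 := ((analyticOnNhd_traceForm (gram W) 0 trivial).continuousAt.tendsto.comp h4).cexp
      simpa [traceForm, Function.comp_def] using h5
    have h6 := tendsto_map_rep hpoly (fun y => (g y)⁻¹) (f := nhdsWithin 0 (Set.Ioi 0)) (by
      intro i j
      refine (tendsto_inv_autDenom ε v i j).congr' ?_
      filter_upwards [self_mem_nhdsWithin] with y hy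
      rw [Matrix.coe_units_inv, hg y hy]) θ (Q.eval (gram W))
    simpa using h1.mul (h3.mul h6)
  refine tendsto_nhds_unique (hL.congr' ?_) hR
  filter_upwards [self_mem_nhdsWithin] with y hy
  have hmem := scalarPoint_mem (σ := Fin n) hy
  have h1 := hQ (lowerUnip ε v) (lowerUnip_mem ε v) (lowerUnip ε 0) (lowerUnip_mem ε 0)
    (fun Z => Complex.log (unipDenom ε v' Z))
    (by rw [upDown_lowerUnip]; exact isLogDet_lowerUnip ε v')
    (fun Z => Complex.exp (traceForm (gram W) Z))
    (fun Z _ => ((analyticOnNhd_traceForm (gram W) Z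
      trivial).differentiableAt.cexp).differentiableWithinAt)
    _ hmem _ hmem (g y) 1 (hg y hy) (by
      rw [autDenom_lowerUnip]
      ext i j
      simp [Matrix.vecMulVec_apply])
  rw [pullbackOp, pullbackOp, diffOp_exp, blockDiag_scalarPoint, upDown_lowerUnip, ← hv'] at h1
  have h2 : Q.diffOp (slash s (lowerUnip ε v') (fun Z => Complex.log (unipDenom ε v' Z))
      fun Z => Complex.exp (traceForm (gram W) Z)) (scalarPoint (Fin n ⊕ Fin n) y) =
      Q.diffOp F (scalarPoint (Fin n ⊕ Fin n) y) :=
    diffOp_congr Q hU (fun Z hZ => slash_lowerUnip s W ε v' hZ)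
      (unipDenom_mem_slitPlane ε v' (scalarPoint_mem hy))
  rw [h2] at h1
  have h3 := congrArg θ h1
  simpa only [map_smul, smul_eq_mul, inv_one] using h3

/-- The scalar polynomial `θ ∘ Q`. -/
def SymPoly.toMvPolynomial {σ W : Type*} [AddCommGroup W] [Module ℂ W] (Q : SymPoly σ W)
    (θ : Module.Dual ℂ W) : MvPolynomial (Sym2 σ) ℂ :=
  Q.sum fun m c => MvPolynomial.monomial m (θ c)

theorem eval_toMvPolynomial {σ : Type} {W : Type*} [AddCommGroup W] [Module ℂ W] (Q : SymPoly σ W)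
    (θ : Module.Dual ℂ W) (X : SymMat σ) :
    MvPolynomial.eval X (Q.toMvPolynomial θ) = θ (Q.eval X) := by
  simp [SymPoly.toMvPolynomial, SymPoly.eval, Finsupp.sum, MvPolynomial.eval_monomial, mul_comm]

theorem gram_fromCols {κ : Type*} [Fintype κ] (X Y : Matrix κ (Fin n) ℂ) :
    gram (Matrix.fromCols X Y) = blocks (Xᵀ * X) (Xᵀ * Y) (Yᵀ * Y) := by
  rw [gram, blocks, Matrix.transpose_fromCols, Matrix.fromRows_mul_fromCols,
    Matrix.transpose_mul, Matrix.transpose_transpose]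

/-- Covariance in the first variable makes `X ↦ θ (Q(XᵗX, XᵗY, YᵗY))` pluriharmonic. -/
theorem isPluriharmonic_gramSubst {l : ℕ} (hpoly : IsPolynomialRep ρ)
    {Q : SymPoly (Fin n ⊕ Fin n) (V ⊗[ℂ] V)} (hQ : IsCovariant ρ ((l : ℂ) / 2) Q)
    (θ : Module.Dual ℂ (V ⊗[ℂ] V)) (Y : Matrix (Fin l) (Fin n) ℂ) :
    IsPluriharmonic (gramSubst Y (Q.toMvPolynomial θ)) := by
  refine isPluriharmonic_of_deriv _ fun x v => ?_
  set W := Matrix.fromCols (Matrix.of fun k i => x (k, i)) Y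
  have h := sum_deriv_deriv_eval_gram Q θ W (fun i => ((Sum.elim v 0 i : ℝ) : ℂ)) (fun ε => by
    rw [Fintype.card_fin]
    exact eval_gram_eq_diffOp_unipSlash hpoly hQ W ε v)
  refine Eq.trans (Finset.sum_congr rfl fun k _ => ?_) h
  congr 2
  ext t
  rw [eval_gramSubst, eval_toMvPolynomial, ← gram_fromCols]
  congr 3
  ext k' (i | i)
  · by_cases hk : k' = k
    · subst hk; simp [W, shiftRow]
    · simp [W, shiftRow, hk]
  · by_cases hk : k' = k
    · subst hk; simp [W, shiftRow]
    · simp [W, shiftRow, hk]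

/-- The complexification of a real invertible matrix. -/
def complexify : GL (Fin n) ℝ →* GL (Fin n) ℂ := Matrix.GeneralLinearGroup.map Complex.ofRealHom

theorem complexify_apply (d : GL (Fin n) ℝ) (i j : Fin n) :
    (complexify d : Matrix (Fin n) (Fin n) ℂ) i j = ((d : Matrix (Fin n) (Fin n) ℝ) i j : ℂ) := rfl

/-- The symplectic matrix `(dᵗ 0; 0 d⁻¹)`. -/
def leviMatrix (d : GL (Fin n) ℝ) : Matrix (Fin n ⊕ Fin n) (Fin n ⊕ Fin n) ℝ :=
  Matrix.fromBlocks (d : Matrix (Fin n) (Fin n) ℝ)ᵀ 0 0 ((d⁻¹ : GL (Fin n) ℝ) : Matrix _ _ ℝ)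

theorem leviMatrix_mem (d : GL (Fin n) ℝ) :
    leviMatrix d ∈ Matrix.symplecticGroup (Fin n) ℝ := by
  rw [leviMatrix, SymplecticGroup.fromBlocks_mem_iff]
  simp

theorem autDenom_leviMatrix (d : GL (Fin n) ℝ) (Z : SymMat (Fin n)) :
    autDenom (leviMatrix d) Z = ((complexify d)⁻¹ : GL (Fin n) ℂ) := by
  rw [← map_inv]
  simp only [autDenom, leviMatrix, Matrix.toBlocks_fromBlocks₂₁, Matrix.toBlocks_fromBlocks₂₂]
  ext i j
  simp [complexify_apply, -Matrix.coe_units_inv, -map_inv]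

theorem moebius_leviMatrix (d : GL (Fin n) ℝ) (Z : SymMat (Fin n)) :
    moebius (leviMatrix d) Z = symOfMatrix
      (((complexify d : GL (Fin n) ℂ) : Matrix (Fin n) (Fin n) ℂ)ᵀ * Z.toMatrix * ((complexify d : GL (Fin n) ℂ) : Matrix (Fin n) (Fin n) ℂ)) := by
  rw [moebius, autDenom_leviMatrix, ← Matrix.coe_units_inv, inv_inv]
  simp only [leviMatrix, Matrix.toBlocks_fromBlocks₁₁, Matrix.toBlocks_fromBlocks₁₂]
  congr 3
  ext i j
  simp [complexify, Matrix.mul_apply]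

/-- The block diagonal complex matrix `(d₁ 0; 0 d₂)`. -/
def diagPair (d₁ d₂ : GL (Fin n) ℝ) : Matrix (Fin n ⊕ Fin n) (Fin n ⊕ Fin n) ℂ :=
  Matrix.fromBlocks (complexify d₁ : GL (Fin n) ℂ) 0 0 (complexify d₂ : GL (Fin n) ℂ)

theorem diagPair_mul_inv (d₁ d₂ : GL (Fin n) ℝ) : diagPair d₁ d₂ * diagPair d₁⁻¹ d₂⁻¹ = 1 := by
  simp only [diagPair, map_inv, Matrix.fromBlocks_multiply, zero_mul, mul_zero, add_zero, zero_add,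
    ← Units.val_mul, mul_inv_cancel, Units.val_one, Matrix.fromBlocks_one]

theorem autDenom_upDown_leviMatrix (d₁ d₂ : GL (Fin n) ℝ) (Z : SymMat (Fin n ⊕ Fin n)) :
    autDenom (upDown (leviMatrix d₁) (leviMatrix d₂)) Z = diagPair d₁⁻¹ d₂⁻¹ := by
  ext (i | i) (j | j) <;>
    simp [autDenom, upDown, leviMatrix, diagPair, complexify_apply, -Matrix.coe_units_inv, -map_inv]

theorem moebius_upDown_leviMatrix (d₁ d₂ : GL (Fin n) ℝ) (Z : SymMat (Fin n ⊕ Fin n)) :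
    moebius (upDown (leviMatrix d₁) (leviMatrix d₂)) Z =
      symOfMatrix ((diagPair d₁ d₂)ᵀ * Z.toMatrix * diagPair d₁ d₂) := by
  rw [moebius, autDenom_upDown_leviMatrix, Matrix.inv_eq_left_inv (diagPair_mul_inv d₁ d₂)]
  congr 2
  have h1 : (upDown (leviMatrix d₁) (leviMatrix d₂)).toBlocks₁₂ = 0 := by
    simp [upDown, leviMatrix]
  have h2 : (upDown (leviMatrix d₁) (leviMatrix d₂)).toBlocks₁₁.map Complex.ofReal =
      (diagPair d₁ d₂)ᵀ := by
    ext (i | i) (j | j) <;> simp [upDown, leviMatrix, diagPair, complexify]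
  rw [h1, h2]
  ext i j
  simp

/-- Cyclicity of the trace moves the action of a Levi element from Z to the frequency T of the
exponential. -/
theorem traceForm_symOfMatrix {σ : Type} [Fintype σ] [DecidableEq σ] (T Z : SymMat σ)
    (D : Matrix σ σ ℂ) :
    traceForm T (symOfMatrix (Dᵀ * Z.toMatrix * D)) =
      traceForm (symOfMatrix (D * T.toMatrix * Dᵀ)) Z := by
  rw [traceForm_eq_trace, traceForm_eq_trace, toMatrix_symOfMatrix, toMatrix_symOfMatrix]
  · rw [Matrix.trace_mul_comm, Matrix.mul_assoc, Matrix.mul_assoc, Matrix.trace_mul_comm]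
    simp only [Matrix.mul_assoc]
    rw [Matrix.trace_mul_comm]
    simp only [Matrix.mul_assoc]
  · simp [Matrix.transpose_mul, toMatrix_transpose, Matrix.mul_assoc]
  · simp [Matrix.transpose_mul, toMatrix_transpose, Matrix.mul_assoc]

/-- Covariance under Levi elements, tested on an exponential at one point: the two sides carry the
same non-zero scalar factors, which cancel. -/
theorem map_rep_eval {s : ℂ} {Q : SymPoly (Fin n ⊕ Fin n) (V ⊗[ℂ] V)} (hQ : IsCovariant ρ s Q)
    (d₁ d₂ : GL (Fin n) ℝ) (T : SymMat (Fin n ⊕ Fin n)) :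
    TensorProduct.map (ρ (complexify d₁)) (ρ (complexify d₂)) (Q.eval T) =
      Q.eval (symOfMatrix (diagPair d₁ d₂ * T.toMatrix * (diagPair d₁ d₂)ᵀ)) := by
  set T' := symOfMatrix (diagPair d₁ d₂ * T.toMatrix * (diagPair d₁ d₂)ᵀ)
  have hdet : (diagPair d₁⁻¹ d₂⁻¹).det ≠ 0 := by
    intro h
    have := congrArg Matrix.det (diagPair_mul_inv d₁ d₂)
    rw [Matrix.det_mul, h, mul_zero, Matrix.det_one] at this
    exact zero_ne_one this
  have hmem := scalarPoint_mem (σ := Fin n) zero_lt_one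
  have h1 := hQ (leviMatrix d₁) (leviMatrix_mem d₁) (leviMatrix d₂) (leviMatrix_mem d₂)
    -- For Levi elements C = 0, so det(CZ + D) is constant and any logarithm of it is a branch.
    (fun _ => Complex.log (diagPair d₁⁻¹ d₂⁻¹).det)
    ⟨differentiableOn_const _, fun Z _ => by
      rw [autDenom_upDown_leviMatrix, Complex.exp_log hdet]⟩
    (fun Z => Complex.exp (traceForm T Z))
    (fun Z _ => ((analyticOnNhd_traceForm T Z
      trivial).differentiableAt.cexp).differentiableWithinAt)
    _ hmem _ hmem (complexify d₁)⁻¹ (complexify d₂)⁻¹ (autDenom_leviMatrix d₁ _).symm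
    (autDenom_leviMatrix d₂ _).symm
  have h2 : blockDiag (moebius (leviMatrix d₁) (scalarPoint (Fin n) 1))
      (moebius (leviMatrix d₂) (scalarPoint (Fin n) 1)) =
      symOfMatrix ((diagPair d₁ d₂)ᵀ * (scalarPoint (Fin n ⊕ Fin n) 1).toMatrix *
        diagPair d₁ d₂) := by
    rw [moebius_leviMatrix, moebius_leviMatrix, blockDiag, toMatrix_symOfMatrix,
      toMatrix_symOfMatrix]
    · congr 1
      simp only [toMatrix_scalarPoint, diagPair, Matrix.mul_smul, mul_one, Matrix.smul_mul,
        Matrix.fromBlocks_transpose, Matrix.fromBlocks_multiply, Matrix.transpose_zero, mul_zero,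
        zero_mul, add_zero, zero_add, Matrix.fromBlocks_smul, smul_zero]
    · simp [Matrix.transpose_mul, toMatrix_transpose, Matrix.mul_assoc]
    · simp [Matrix.transpose_mul, toMatrix_transpose, Matrix.mul_assoc]
  have h3 : slash s (upDown (leviMatrix d₁) (leviMatrix d₂))
      (fun _ => Complex.log (diagPair d₁⁻¹ d₂⁻¹).det) (fun Z => Complex.exp (traceForm T Z)) =
      fun Z => Complex.exp (-s * Complex.log (diagPair d₁⁻¹ d₂⁻¹).det) *
        Complex.exp (traceForm T' Z) := by
    ext Z
    rw [slash, moebius_upDown_leviMatrix, traceForm_symOfMatrix]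
  rw [pullbackOp, pullbackOp, h3, diffOp_const_mul, diffOp_exp, diffOp_exp, h2,
    traceForm_symOfMatrix, blockDiag_scalarPoint, inv_inv, inv_inv, map_smul] at h1
  have h4 := smul_right_injective (V ⊗[ℂ] V) (Complex.exp_ne_zero _) h1
  exact smul_right_injective (V ⊗[ℂ] V) (Complex.exp_ne_zero _) h4

end Covariance

/-! ### Zariski density of real Gram matrices -/

section GramDensity

variable {σ : Type} [Fintype σ] [DecidableEq σ]

theorem exists_transpose_mul_self_eq_add {M : Matrix σ σ ℝ} (hM : M.IsHermitian) :
    ∃ t₀ : ℝ, ∀ t ≥ t₀, ∃ W : Matrix σ σ ℝ, Wᵀ * W = M + t • (1 : Matrix σ σ ℝ) := by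
  -- The sum bounds every |eigenvalue|, so M + t is positive semidefinite and has a square root.
  refine ⟨∑ i, |hM.eigenvalues i|, fun t ht => ?_⟩
  set U : Matrix σ σ ℝ := (hM.eigenvectorUnitary : Matrix σ σ ℝ)
  have hU : U * Uᵀ = 1 := by
    have := Unitary.coe_mul_star_self hM.eigenvectorUnitary
    simpa [Matrix.star_eq_conjTranspose] using this
  have hspec : M = U * Matrix.diagonal hM.eigenvalues * Uᵀ := by
    have := hM.spectral_theorem
    simpa [Unitary.conjStarAlgAut_apply, Matrix.star_eq_conjTranspose, Function.comp_def] using this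
  have hpos : ∀ i, 0 ≤ hM.eigenvalues i + t := by
    intro i
    have h1 : |hM.eigenvalues i| ≤ ∑ i, |hM.eigenvalues i| :=
      Finset.single_le_sum (f := fun i => |hM.eigenvalues i|) (fun i _ => abs_nonneg _)
        (Finset.mem_univ i)
    have h2 := neg_abs_le (hM.eigenvalues i)
    linarith
  refine ⟨Matrix.diagonal (fun i => √(hM.eigenvalues i + t)) * Uᵀ, ?_⟩
  have h3 : Matrix.diagonal (fun i => √(hM.eigenvalues i + t)) *
      Matrix.diagonal (fun i => √(hM.eigenvalues i + t)) =
      Matrix.diagonal hM.eigenvalues + t • (1 : Matrix σ σ ℝ) := by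
    rw [Matrix.diagonal_mul_diagonal, Matrix.smul_one_eq_diagonal, Matrix.diagonal_add]
    congr 1
    ext i
    exact Real.mul_self_sqrt (hpos i)
  rw [Matrix.transpose_mul, Matrix.transpose_transpose, Matrix.diagonal_transpose, Matrix.mul_assoc,
    ← Matrix.mul_assoc (Matrix.diagonal _), h3, add_mul, mul_add, ← Matrix.mul_assoc, ← hspec,
    Matrix.smul_mul, one_mul, Matrix.mul_smul, hU]

theorem eq_zero_of_eval_gram (q : MvPolynomial (Sym2 σ) ℂ)
    (h : ∀ W : Matrix σ σ ℝ, MvPolynomial.eval (gram (W.map Complex.ofReal)) q = 0) : q = 0 := by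
  classical
  apply eq_zero_of_eval_ofReal
  intro x
  let M : Matrix σ σ ℝ := Matrix.of fun i j => x s(i, j)
  have hM : M.IsHermitian := by
    ext i j
    simp [M, Sym2.eq_swap]
  obtain ⟨t₀, ht₀⟩ := exists_transpose_mul_self_eq_add hM
  -- The restriction of q to the line x + t·1. For large real t this is a Gram matrix, so p has
  -- infinitely many roots; then p = 0 and q(x) = p(0) = 0.
  let p : Polynomial ℂ := MvPolynomial.aeval (fun s : Sym2 σ =>
    Polynomial.C (x s : ℂ) + Polynomial.C (if s.IsDiag then 1 else 0) * Polynomial.X) q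
  have hp : ∀ t : ℂ, p.eval t = MvPolynomial.eval
      (fun s => (x s : ℂ) + (if s.IsDiag then 1 else 0) * t) q := by
    intro t
    have h1 : (Polynomial.aeval t).comp (MvPolynomial.aeval (fun s : Sym2 σ =>
        Polynomial.C (x s : ℂ) + Polynomial.C (if s.IsDiag then 1 else 0) * Polynomial.X)) =
        MvPolynomial.aeval (R := ℂ) (fun s => (x s : ℂ) + (if s.IsDiag then 1 else 0) * t) := by
      apply MvPolynomial.algHom_ext
      intro s
      simp only [AlgHom.comp_apply, MvPolynomial.aeval_X, Polynomial.coe_aeval_eq_eval]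
      split_ifs <;> simp
    have h2 := DFunLike.congr_fun h1 q
    simpa [MvPolynomial.aeval_eq_eval, p, Polynomial.coe_aeval_eq_eval] using h2
  have hroot : ∀ t : ℝ, t₀ ≤ t → p.IsRoot (t : ℂ) := by
    intro t ht
    obtain ⟨W, hW⟩ := ht₀ t ht
    rw [Polynomial.IsRoot, hp]
    refine Eq.trans ?_ (h W)
    congr 2
    ext s
    induction s with
    | h i j =>
      have h1 := congrArg Complex.ofReal (congrFun (congrFun hW i) j)
      rw [gram_mk]
      simp only [Matrix.mul_apply, Matrix.transpose_apply, Complex.ofReal_sum,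
        Complex.ofReal_mul] at h1
      simp only [Matrix.map_apply]
      rw [h1]
      simp [M, Matrix.one_apply, apply_ite Complex.ofReal, Sym2.mk_isDiag_iff]
  have hp0 : p = 0 := by
    refine Polynomial.eq_zero_of_infinite_isRoot p
      (((Set.Ici_infinite t₀).image Complex.ofReal_injective.injOn).mono ?_)
    rintro _ ⟨t, ht, rfl⟩
    exact hroot t ht
  have := hp 0
  rw [hp0] at this
  simpa using this.symm

theorem SymPoly.eq_zero_of_toMvPolynomial {σ W : Type*} [AddCommGroup W] [Module ℂ W]
    {Q : SymPoly σ W} (h : ∀ θ : Module.Dual ℂ W, Q.toMvPolynomial θ = 0) : Q = 0 := by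
  ext m
  rw [Finsupp.zero_apply, ← Module.forall_dual_apply_eq_zero_iff ℂ]
  intro θ
  classical
  have h1 := congrArg (MvPolynomial.coeff m) (h θ)
  simp only [SymPoly.toMvPolynomial, Finsupp.sum, MvPolynomial.coeff_sum, MvPolynomial.coeff_monomial,
    Finset.sum_ite_eq', MvPolynomial.coeff_zero] at h1
  by_cases hm : m ∈ Q.support
  · rwa [if_pos hm] at h1
  · rw [Finsupp.notMem_support_iff.1 hm, map_zero]

end GramDensity

/-! ### Equivariance of Q^• and Schur's lemma -/

section Equivariance

variable {n : ℕ} {V : Type*} [AddCommGroup V] [Module ℂ V]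
  {ρ : Representation ℂ (GL (Fin n) ℂ) V} {B : LinearMap.BilinForm ℂ V}

/-- The transpose of an invertible matrix. -/
def transposeGL {R : Type*} [CommRing R] (g : GL (Fin n) R) : GL (Fin n) R where
  val := (g : Matrix (Fin n) (Fin n) R)ᵀ
  inv := ((g⁻¹ : GL (Fin n) R) : Matrix (Fin n) (Fin n) R)ᵀ
  val_inv := by rw [← Matrix.transpose_mul, ← Units.val_mul, inv_mul_cancel]; simp
  inv_val := by rw [← Matrix.transpose_mul, ← Units.val_mul, mul_inv_cancel]; simp

theorem coe_transposeGL {R : Type*} [CommRing R] (g : GL (Fin n) R) :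
    (transposeGL g : Matrix (Fin n) (Fin n) R) = (g : Matrix (Fin n) (Fin n) R)ᵀ := rfl

theorem complexify_transposeGL (d : GL (Fin n) ℝ) :
    complexify (transposeGL d) = transposeGL (complexify d) := by
  ext i j
  rfl

theorem bullet_tmul (v₁ v₂ v : V) : bullet B (v₁ ⊗ₜ v₂) v = B v v₁ • v₂ := by
  simp [bullet]

/-- Transpose invariance moves ρ(g) to the other argument of the form, which is why the first tensor
factor acts on the right and through gᵗ. -/
theorem bullet_map (hBρ : IsTransposeInvariant ρ B) (g h : GL (Fin n) ℂ) (x : V ⊗[ℂ] V) :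
    bullet B (TensorProduct.map (ρ g) (ρ h) x) = ρ h * bullet B x * ρ (transposeGL g) := by
  induction x using TensorProduct.induction_on with
  | zero => simp
  | add x y hx hy => simp only [map_add, hx, hy, mul_add, add_mul]
  | tmul v w =>
    ext u
    simp only [TensorProduct.map_tmul, bullet_tmul, Module.End.mul_apply, map_smul]
    rw [hBρ g (transposeGL g) rfl]

theorem bullet_injective [FiniteDimensional ℂ V] (hB : B.Nondegenerate) :
    Function.Injective (bullet B) := by
  have h1 : Function.Injective B.flip := by
    rw [injective_iff_map_eq_zero]
    intro v hv
    exact hB.2 v fun x => by simpa using DFunLike.congr_fun hv x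
  have h2 : Function.Injective (TensorProduct.map B.flip (LinearMap.id : V →ₗ[ℂ] V)) :=
    Module.Flat.rTensor_preserves_injective_linearMap (M := V) B.flip h1
  have h3 : Function.Injective (dualTensorHom ℂ V V) :=
    (dualTensorHomEquiv ℂ V V).injective
  exact h3.comp h2

theorem schur [FiniteDimensional ℂ V] (hirr : ρ.IsIrreducible) (f : Module.End ℂ V)
    (hf : ∀ g, f * ρ g = ρ g * f) : ∃ c : ℂ, f = c • (1 : Module.End ℂ V) := by
  have := hirr
  obtain ⟨c, hc⟩ := (Representation.IsIrreducible.algebraMap_intertwiningMap_bijective_of_isAlgClosed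
    (ρ := ρ)).2 ⟨f, hf⟩
  exact ⟨c, congrArg (fun e => e.toLinearMap) hc.symm⟩

/-- An operator commuting with `GL(n, ℝ)` commutes with `GL(n, ℂ)`. -/
theorem commute_of_commute_complexify (hpoly : IsPolynomialRep ρ) (f : Module.End ℂ V)
    (hf : ∀ d : GL (Fin n) ℝ, f * ρ (complexify d) = ρ (complexify d) * f) (g : GL (Fin n) ℂ) :
    f * ρ g = ρ g * f := by
  ext v
  rw [← sub_eq_zero, ← Module.forall_dual_apply_eq_zero_iff ℂ]
  intro φ
  obtain ⟨p, hp⟩ := hpoly (φ ∘ₗ f) v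
  obtain ⟨q, hq⟩ := hpoly φ (f v)
  have h1 : ∀ g, φ ((f * ρ g) v - (ρ g * f) v) =
      MvPolynomial.eval (fun ij => (g : Matrix (Fin n) (Fin n) ℂ) ij.1 ij.2) (p - q) := by
    intro g
    rw [map_sub, map_sub, ← hp, ← hq]
    rfl
  have h2 : p - q = 0 := by
    apply eq_zero_of_eval_GL
    intro d
    have := h1 (complexify d)
    rw [hf, sub_self, map_zero] at this
    exact this.symm
  rw [h1, h2, map_zero]

theorem map_rep_eval_blocks {s : ℂ} {Q : SymPoly (Fin n ⊕ Fin n) (V ⊗[ℂ] V)}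
    (hQ : IsCovariant ρ s Q) (d₁ d₂ : GL (Fin n) ℝ) {A U C : Matrix (Fin n) (Fin n) ℂ}
    (hA : Aᵀ = A) (hC : Cᵀ = C) :
    TensorProduct.map (ρ (complexify d₁)) (ρ (complexify d₂)) (Q.eval (blocks A U C)) =
      Q.eval (blocks
        ((complexify d₁ : GL (Fin n) ℂ) * A * (complexify d₁ : Matrix (Fin n) (Fin n) ℂ)ᵀ)
        ((complexify d₁ : GL (Fin n) ℂ) * U * (complexify d₂ : Matrix (Fin n) (Fin n) ℂ)ᵀ)
        ((complexify d₂ : GL (Fin n) ℂ) * C * (complexify d₂ : Matrix (Fin n) (Fin n) ℂ)ᵀ)) := by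
  rw [map_rep_eval hQ, blocks, blocks, toMatrix_symOfMatrix]
  · congr 2
    simp only [diagPair, Matrix.fromBlocks_transpose, Matrix.fromBlocks_multiply,
      Matrix.transpose_zero, mul_zero, zero_mul, add_zero, zero_add, Matrix.transpose_mul,
      Matrix.transpose_transpose, Matrix.mul_assoc]
  · rw [Matrix.fromBlocks_transpose, hA, hC, Matrix.transpose_transpose]

variable {s : ℂ} {Q : SymPoly (Fin n ⊕ Fin n) (V ⊗[ℂ] V)}

theorem bullet_eval_blocks (hBρ : IsTransposeInvariant ρ B) (hQ : IsCovariant ρ s Q)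
    (d₁ d₂ : GL (Fin n) ℝ) {A U C : Matrix (Fin n) (Fin n) ℂ} (hA : Aᵀ = A) (hC : Cᵀ = C) :
    bullet B (Q.eval (blocks
      ((complexify d₁ : GL (Fin n) ℂ) * A * (complexify d₁ : Matrix (Fin n) (Fin n) ℂ)ᵀ)
      ((complexify d₁ : GL (Fin n) ℂ) * U * (complexify d₂ : Matrix (Fin n) (Fin n) ℂ)ᵀ)
      ((complexify d₂ : GL (Fin n) ℂ) * C * (complexify d₂ : Matrix (Fin n) (Fin n) ℂ)ᵀ))) =
      ρ (complexify d₂) * bullet B (Q.eval (blocks A U C)) * ρ (complexify (transposeGL d₁)) := by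
  rw [← map_rep_eval_blocks hQ d₁ d₂ hA hC, bullet_map hBρ, complexify_transposeGL]

/-- The real scalar matrix `t`. -/
def scalarGL (t : ℝˣ) : GL (Fin n) ℝ := Units.map (Matrix.scalar (Fin n)).toMonoidHom t

theorem coe_complexify_scalarGL (t : ℝˣ) :
    ((complexify (scalarGL t) : GL (Fin n) ℂ) : Matrix (Fin n) (Fin n) ℂ) =
      ((t : ℝ) : ℂ) • (1 : Matrix (Fin n) (Fin n) ℂ) := by
  ext i j
  rw [complexify_apply]
  by_cases h : i = j
  · subst h; simp [scalarGL]
  · simp [scalarGL, h]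

theorem rep_scalarGL [FiniteDimensional ℂ V] (hirr : ρ.IsIrreducible) (t : ℝˣ) :
    ∃ c : ℂ, ρ (complexify (scalarGL t)) = c • (1 : Module.End ℂ V) := by
  refine schur hirr _ fun g => ?_
  rw [← map_mul, ← map_mul]
  congr 1
  ext i j
  rw [Units.val_mul, Units.val_mul, coe_complexify_scalarGL]
  simp

/-- The scalar matrix t acts through the same scalar c on either tensor factor. From (0, t⁻¹U, C),
acting on the first factor gives (0, U, C) and on the second gives (0, U, t²C). -/
theorem eval_blocks_zero_smul [FiniteDimensional ℂ V] (hirr : ρ.IsIrreducible)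
    (hB : B.Nondegenerate) (hBρ : IsTransposeInvariant ρ B) (hQ : IsCovariant ρ s Q)
    (U : Matrix (Fin n) (Fin n) ℂ) {C : Matrix (Fin n) (Fin n) ℂ} (hC : Cᵀ = C) (t : ℝˣ) :
    Q.eval (blocks 0 U (((t : ℝ) ^ 2 : ℂ) • C)) = Q.eval (blocks 0 U C) := by
  obtain ⟨c, hc⟩ := rep_scalarGL hirr t
  have ht : ((t : ℝ) : ℂ) ≠ 0 := by simp
  have hT : transposeGL (scalarGL t : GL (Fin n) ℝ) = scalarGL t := by
    ext i j
    exact congrFun (congrFun (Matrix.diagonal_transpose fun _ => (t : ℝ)) i) j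
  have hT1 : transposeGL (1 : GL (Fin n) ℝ) = 1 := by
    ext i j
    simp [coe_transposeGL, Matrix.one_apply, eq_comm]
  have h1 := bullet_eval_blocks hBρ hQ (scalarGL t) 1 (A := 0)
    (U := ((t : ℝ) : ℂ)⁻¹ • U) (by simp) hC
  have h2 := bullet_eval_blocks hBρ hQ 1 (scalarGL t) (A := 0)
    (U := ((t : ℝ) : ℂ)⁻¹ • U) (by simp) hC
  rw [hT, hc, map_one, map_one, coe_complexify_scalarGL] at h1
  rw [hT1, hc, map_one, map_one, coe_complexify_scalarGL] at h2
  generalize ((t : ℝ) : ℂ) = τ at *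
  simp [smul_smul, ht] at h1 h2
  apply bullet_injective hB
  rw [h1, sq, h2]

/-- The value at t²C is constant for t ≠ 0 and continuous in t; let t tend to 0. -/
theorem eval_blocks_zero [FiniteDimensional ℂ V] (hirr : ρ.IsIrreducible)
    (hB : B.Nondegenerate) (hBρ : IsTransposeInvariant ρ B) (hQ : IsCovariant ρ s Q)
    (U : Matrix (Fin n) (Fin n) ℂ) {C : Matrix (Fin n) (Fin n) ℂ} (hC : Cᵀ = C) :
    Q.eval (blocks 0 U C) = Q.eval (blocks 0 U 0) := by
  rw [← sub_eq_zero, ← Module.forall_dual_apply_eq_zero_iff ℂ]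
  intro θ
  rw [map_sub, sub_eq_zero]
  have hcont : Continuous fun t : ℝ => θ (Q.eval (blocks 0 U (((t : ℝ) ^ 2 : ℂ) • C))) := by
    simp only [← eval_toMvPolynomial]
    refine (MvPolynomial.continuous_eval _).comp (continuous_pi fun p => ?_)
    induction p with
    | h i j =>
      rcases i with i | i <;> rcases j with j | j <;> simp [blocks, symOfMatrix] <;> fun_prop
  have h1 : Filter.Tendsto (fun t : ℝ => θ (Q.eval (blocks 0 U (((t : ℝ) ^ 2 : ℂ) • C))))
      (nhdsWithin 0 {0}ᶜ) (nhds (θ (Q.eval (blocks 0 U 0)))) := by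
    have := (hcont.tendsto 0).mono_left (nhdsWithin_le_nhds (s := {0}ᶜ))
    simpa using this
  refine tendsto_nhds_unique (tendsto_const_nhds.congr' ?_) h1
  filter_upwards [self_mem_nhdsWithin] with t ht
  exact congrArg θ (eval_blocks_zero_smul hirr hB hBρ hQ U hC (Units.mk0 t ht)).symm

theorem exists_eval_blocks_one [FiniteDimensional ℂ V] (hirr : ρ.IsIrreducible)
    (hpoly : IsPolynomialRep ρ) (hBρ : IsTransposeInvariant ρ B) (hQ : IsCovariant ρ s Q) :
    ∃ c : ℂ, bullet B (Q.eval (blocks 0 1 0)) = c • (1 : Module.End ℂ V) := by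
  refine schur hirr _ (commute_of_commute_complexify hpoly _ fun d => ?_)
  -- The pair (dᵗ, d⁻¹) fixes the blocks (0, 1, 0), since dᵗ(d⁻¹)ᵗ = 1. Equivariance then reads f =
  -- ρ(d)⁻¹ f ρ(d).
  set d' := transposeGL d
  have hd : transposeGL d' = d := by ext i j; rfl
  have h1 := bullet_eval_blocks hBρ hQ d' d⁻¹ (A := 0) (U := 1) (C := 0) (by simp) (by simp)
  rw [hd] at h1
  have h2 : ((complexify d' : GL (Fin n) ℂ) : Matrix (Fin n) (Fin n) ℂ) *
      ((complexify d⁻¹ : GL (Fin n) ℂ) : Matrix (Fin n) (Fin n) ℂ)ᵀ = 1 := by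
    rw [complexify_transposeGL, coe_transposeGL, ← Matrix.transpose_mul, ← Units.val_mul,
      ← map_mul, inv_mul_cancel, map_one, Units.val_one, Matrix.transpose_one]
  simp only [mul_one, mul_zero, zero_mul, h2] at h1
  conv_rhs => rw [h1]
  rw [← mul_assoc, ← mul_assoc, ← map_mul, ← map_mul, mul_inv_cancel, map_one, map_one, one_mul]

end Equivariance

/-! ### Non-vanishing of Q(0, 1, 0) and invertibility of Q(T, T, T)^• -/

section Nondegeneracy

variable {n l : ℕ} {V : Type*} [AddCommGroup V] [Module ℂ V]
  {ρ : Representation ℂ (GL (Fin n) ℂ) V} {B : LinearMap.BilinForm ℂ V}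

/-- An isometric embedding of `2n`-dimensional space into `l`-dimensional space. -/
theorem exists_isometry (hl : 2 * n ≤ l) :
    ∃ P : Matrix (Fin l) (Fin n ⊕ Fin n) ℝ, Pᵀ * P = 1 := by
  let e : Fin n ⊕ Fin n ↪ Fin l :=
    (finSumFinEquiv.toEmbedding).trans (Fin.castLEEmb (by omega))
  refine ⟨Matrix.of fun k i => if k = e i then 1 else 0, ?_⟩
  ext i j
  simp [Matrix.mul_apply, Matrix.one_apply, e.injective.eq_iff, eq_comm]

theorem transpose_mul_mul_of_isometry {ι κ μ ν : Type*} [Fintype ι] [Fintype κ] [DecidableEq κ]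
    {P : Matrix ι κ ℝ} (hP : Pᵀ * P = 1) (M : Matrix κ μ ℝ) (N : Matrix κ ν ℝ) :
    (P * M)ᵀ * (P * N) = Mᵀ * N := by
  rw [Matrix.transpose_mul, Matrix.mul_assoc, ← Matrix.mul_assoc Pᵀ, hP, Matrix.one_mul]

variable {Q : SymPoly (Fin n ⊕ Fin n) (V ⊗[ℂ] V)}

theorem map_ofReal_mul {ι κ μ : Type*} [Fintype κ] (X : Matrix ι κ ℝ) (Y : Matrix κ μ ℝ) :
    (X * Y).map Complex.ofReal = X.map Complex.ofReal * Y.map Complex.ofReal :=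
  Matrix.map_mul (f := Complex.ofRealHom)

/-- The scalar `Q(0, 1, 0)` is non-zero: otherwise `Q` would vanish on all Gram matrices. -/
theorem eval_blocks_one_ne_zero [FiniteDimensional ℂ V] (hl : 2 * n ≤ l) (hirr : ρ.IsIrreducible)
    (hpoly : IsPolynomialRep ρ) (hB : B.Nondegenerate) (hBρ : IsTransposeInvariant ρ B)
    (hQ0 : Q ≠ 0) (hQ : IsCovariant ρ ((l : ℂ) / 2) Q) : Q.eval (blocks 0 1 0) ≠ 0 := by
  intro h0
  apply hQ0
  apply SymPoly.eq_zero_of_toMvPolynomial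
  intro θ
  have hzero : ∀ (g : GL (Fin n) ℝ) (C : Matrix (Fin n) (Fin n) ℂ), Cᵀ = C →
      Q.eval (blocks 0 ((g : Matrix (Fin n) (Fin n) ℝ).map Complex.ofReal) C) = 0 := by
    intro g C hC
    rw [eval_blocks_zero hirr hB hBρ hQ _ hC]
    have h1 := map_rep_eval_blocks hQ g 1 (A := 0) (U := 1) (C := 0) (by simp) (by simp)
    rw [h0, map_zero] at h1
    simp only [map_one, Units.val_one, Matrix.transpose_one, mul_one, mul_zero, zero_mul] at h1
    exact h1.symm
  have hgram : ∀ X Y : Matrix (Fin l) (Fin n) ℝ, MvPolynomial.eval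
      (gram (Matrix.fromCols (X.map Complex.ofReal) (Y.map Complex.ofReal)))
      (Q.toMvPolynomial θ) = 0 := by
    intro X Y
    have h1 := gramSubst_eq_zero_of_offDiag Y (Q.toMvPolynomial θ)
      (isPluriharmonic_gramSubst hpoly hQ θ _) (fun g => by
        rw [eval_toMvPolynomial, hzero g _ (by rw [Matrix.transpose_mul, Matrix.transpose_transpose]),
          map_zero])
    have h2 := eval_gramSubst (Y.map Complex.ofReal) (Q.toMvPolynomial θ) fun p => (X p.1 p.2 : ℂ)
    rw [h1, map_zero] at h2
    rw [gram_fromCols]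
    exact h2.symm
  -- Here l ≥ 2n is used: WᵗW = (PW)ᵗ(PW), so every real Gram matrix of size 2n comes from an l × 2n
  -- matrix (X Y).
  obtain ⟨P, hP⟩ := exists_isometry hl
  apply eq_zero_of_eval_gram
  intro W
  have h1 := hgram (P * W).toCols₁ (P * W).toCols₂
  have h2 : Matrix.fromCols ((P * W).toCols₁.map Complex.ofReal)
      ((P * W).toCols₂.map Complex.ofReal) = (P * W).map Complex.ofReal := by
    ext i (j | j) <;> rfl
  have h3 : gram ((P * W).map Complex.ofReal) = gram (W.map Complex.ofReal) := by
    rw [gram, gram, ← Matrix.transpose_map, ← Matrix.transpose_map, ← map_ofReal_mul,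
      ← map_ofReal_mul, transpose_mul_mul_of_isometry hP]
  rwa [h2, h3] at h1

theorem isUnit_bullet_eval_one [FiniteDimensional ℂ V] (hl : 2 * n ≤ l) (hirr : ρ.IsIrreducible)
    (hpoly : IsPolynomialRep ρ) (hB : B.Nondegenerate) (hBρ : IsTransposeInvariant ρ B)
    (hQ0 : Q ≠ 0) (hQ : IsCovariant ρ ((l : ℂ) / 2) Q) :
    IsUnit (bullet B (Q.eval (blocks 1 1 1))) := by
  obtain ⟨c, hc⟩ := exists_eval_blocks_one hirr hpoly hBρ hQ
  have hc0 : c ≠ 0 := by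
    rintro rfl
    rw [zero_smul] at hc
    exact eval_blocks_one_ne_zero hl hirr hpoly hB hBρ hQ0 hQ
      (bullet_injective hB (hc.trans (map_zero _).symm))
  rw [LinearMap.isUnit_iff_range_eq_top]
  by_contra hne
  obtain ⟨u, hu0, hu⟩ := Submodule.exists_le_ker_of_lt_top _ (lt_top_iff_ne_top.2 hne)
  apply hu0
  ext v
  -- Here u is a non-zero functional killing the range of Q(1, 1, 1)^•. Showing u v = 0 for each v
  -- contradicts u ≠ 0.
  let θ : Module.Dual ℂ (V ⊗[ℂ] V) := u ∘ₗ LinearMap.applyₗ v ∘ₗ bullet B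
  have hθ : ∀ x, θ x = u (bullet B x v) := fun _ => rfl
  obtain ⟨P, hP⟩ := exists_isometry hl
  -- Two mutually orthogonal orthonormal n-frames, which exist since l ≥ 2n; Y + iY' is then
  -- isotropic and pairs with Y to the identity.
  set Y : Matrix (Fin l) (Fin n) ℝ := P * Matrix.fromRows 1 0
  set Y' : Matrix (Fin l) (Fin n) ℝ := P * Matrix.fromRows 0 1
  have hYY : Yᵀ * Y = 1 := by
    refine (transpose_mul_mul_of_isometry hP _ _).trans ?_
    rw [Matrix.transpose_fromRows, Matrix.fromCols_mul_fromRows]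
    simp
  have hYY' : Y'ᵀ * Y = 0 := by
    refine (transpose_mul_mul_of_isometry hP _ _).trans ?_
    rw [Matrix.transpose_fromRows, Matrix.fromCols_mul_fromRows]
    simp
  have hY'Y' : Y'ᵀ * Y' = 1 := by
    refine (transpose_mul_mul_of_isometry hP _ _).trans ?_
    rw [Matrix.transpose_fromRows, Matrix.fromCols_mul_fromRows]
    simp
  set Yc := Y.map Complex.ofReal with hYc
  set Yc' := Y'.map Complex.ofReal with hYc'
  have hone : (1 : Matrix (Fin n) (Fin n) ℝ).map Complex.ofReal = 1 :=
    Matrix.map_one _ Complex.ofReal_zero Complex.ofReal_one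
  have hYYc : Ycᵀ * Yc = 1 := by
    rw [hYc, ← Matrix.transpose_map, ← map_ofReal_mul, hYY, hone]
  have hYY'c : Yc'ᵀ * Yc = 0 := by
    rw [hYc, hYc', ← Matrix.transpose_map, ← map_ofReal_mul, hYY']
    ext; simp
  have hYY'c' : Ycᵀ * Yc' = 0 := by
    rw [← Matrix.transpose_inj, Matrix.transpose_mul, Matrix.transpose_transpose, hYY'c,
      Matrix.transpose_zero]
  have hY'Y'c : Yc'ᵀ * Yc' = 1 := by
    rw [hYc', ← Matrix.transpose_map, ← map_ofReal_mul, hY'Y', hone]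
  have hzero := gramSubst_eq_zero_of_mul Y (Q.toMvPolynomial θ)
    (isPluriharmonic_gramSubst hpoly hQ θ _) (fun g => by
      set gc : Matrix (Fin n) (Fin n) ℂ :=
        ((complexify g : GL (Fin n) ℂ) : Matrix (Fin n) (Fin n) ℂ) with hgc
      have hmat : (Matrix.of fun (k : Fin l) (i : Fin n) =>
          (((Y * (g : Matrix (Fin n) (Fin n) ℝ)) (k, i).1 (k, i).2 : ℝ) : ℂ)) = Yc * gc := by
        rw [hYc, hgc]
        exact map_ofReal_mul Y (g : Matrix (Fin n) (Fin n) ℝ)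
      rw [eval_gramSubst, eval_toMvPolynomial, hmat, ← hYc, Matrix.transpose_mul, Matrix.mul_assoc,
        ← Matrix.mul_assoc Ycᵀ, Matrix.mul_assoc gcᵀ, hYYc, one_mul, mul_one, hθ]
      have h1 := bullet_eval_blocks hBρ hQ (transposeGL g) 1 (A := 1) (U := 1) (C := 1)
        (by simp) (by simp)
      simp only [complexify_transposeGL, coe_transposeGL, map_one, Units.val_one,
        Matrix.transpose_one, mul_one, one_mul, Matrix.transpose_transpose] at h1
      rw [hgc, h1]
      exact hu ⟨_, rfl⟩)
  -- Vanishing as a polynomial permits evaluation at the non-real point Y + iY', where θ(P) is Q(0,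
  -- 1, 1)^• tested against u and v, that is, c u(v).
  have h1 := eval_gramSubst Yc (Q.toMvPolynomial θ)
    fun p => (Yc + Complex.I • Yc') p.1 p.2
  rw [hzero, map_zero, eval_toMvPolynomial] at h1
  have hmat : (Matrix.of fun (k : Fin l) (i : Fin n) =>
      (Yc + Complex.I • Yc') (k, i).1 (k, i).2) = Yc + Complex.I • Yc' := rfl
  have hXX : (Yc + Complex.I • Yc')ᵀ * (Yc + Complex.I • Yc') = 0 := by
    rw [Matrix.transpose_add, Matrix.transpose_smul, Matrix.add_mul, Matrix.mul_add, Matrix.mul_add, Matrix.smul_mul,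
      Matrix.mul_smul, Matrix.smul_mul, Matrix.mul_smul, hYYc, hYY'c, hYY'c', hY'Y'c, smul_smul,
      Complex.I_mul_I]
    simp
  have hXY : (Yc + Complex.I • Yc')ᵀ * Yc = 1 := by
    rw [Matrix.transpose_add, Matrix.transpose_smul, Matrix.add_mul, Matrix.smul_mul, hYYc, hYY'c]
    simp
  rw [hmat, hXX, hXY, hYYc, eval_blocks_zero hirr hB hBρ hQ 1 Matrix.transpose_one, hθ, hc] at h1
  simpa [hc0] using h1.symm

theorem evalBlocks_eq (A U C : Matrix (Fin n) (Fin n) ℝ) :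
    evalBlocks Q A U C = Q.eval
      (blocks (A.map Complex.ofReal) (U.map Complex.ofReal) (C.map Complex.ofReal)) := by
  rw [evalBlocks, blocks, Matrix.fromBlocks_map, Matrix.transpose_map]

open scoped MatrixOrder in
theorem exists_eq_mul_transpose {T : Matrix (Fin n) (Fin n) ℝ} (hT : T.PosDef) :
    ∃ d : GL (Fin n) ℝ, T = (d : Matrix (Fin n) (Fin n) ℝ) * (d : Matrix (Fin n) (Fin n) ℝ)ᵀ := by
  obtain ⟨b, hb⟩ := CStarAlgebra.nonneg_iff_eq_star_mul_self.1 hT.posSemidef.nonneg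
  rw [Matrix.star_eq_conjTranspose, Matrix.conjTranspose_eq_transpose_of_trivial] at hb
  have hdet : bᵀ.det ≠ 0 := by
    intro h
    have := hT.det_pos
    rw [hb, Matrix.det_mul, h, zero_mul] at this
    exact lt_irrefl _ this
  exact ⟨Matrix.GeneralLinearGroup.mkOfDetNeZero bᵀ hdet, hb⟩

theorem det_bullet_evalBlocks_ne_zero [FiniteDimensional ℂ V] (hl : 2 * n ≤ l)
    (hirr : ρ.IsIrreducible) (hpoly : IsPolynomialRep ρ) (hB : B.Nondegenerate)
    (hBρ : IsTransposeInvariant ρ B) (hQ0 : Q ≠ 0) (hQ : IsCovariant ρ ((l : ℂ) / 2) Q)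
    {T : Matrix (Fin n) (Fin n) ℝ} (hT : T.PosDef) :
    LinearMap.det (bullet B (evalBlocks Q T T T)) ≠ 0 := by
  obtain ⟨d, hd⟩ := exists_eq_mul_transpose hT
  have h1 := bullet_eval_blocks hBρ hQ d d (A := 1) (U := 1) (C := 1) (by simp) (by simp)
  have h2 : T.map Complex.ofReal =
      (complexify d : GL (Fin n) ℂ) * (complexify d : Matrix (Fin n) (Fin n) ℂ)ᵀ := by
    rw [hd]
    exact map_ofReal_mul _ _
  simp only [mul_one, ← h2] at h1
  rw [evalBlocks_eq, h1]
  have hρ : ∀ g, IsUnit (ρ g) := fun g => (Group.isUnit g).map ρ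
  exact (LinearMap.isUnit_det _ (((hρ _).mul
    (isUnit_bullet_eval_one hl hirr hpoly hB hBρ hQ0 hQ)).mul (hρ _))).ne_zero

end Nondegeneracy

end SiegelDiff

end

theorem proposition3p2 {n l : ℕ} (hl : 2 * n ≤ l)
    {V : Type*} [AddCommGroup V] [Module ℂ V] [FiniteDimensional ℂ V]
    (ρ : Representation ℂ (Matrix.GeneralLinearGroup (Fin n) ℂ) V)
    (hirr : ρ.IsIrreducible) (hpoly : SiegelDiff.IsPolynomialRep ρ)
    (B : LinearMap.BilinForm ℂ V) (hB : B.Nondegenerate)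
    (hBρ : SiegelDiff.IsTransposeInvariant ρ B)
    (Q : SiegelDiff.SymPoly (Fin n ⊕ Fin n) (V ⊗[ℂ] V)) (hQ0 : Q ≠ 0)
    (hQ : SiegelDiff.IsCovariant ρ ((l : ℂ) / 2) Q) :
    (∃ X₀ : Matrix (Fin l) (Fin n) ℝ, X₀.rank = n ∧
      LinearMap.det (SiegelDiff.bullet B (SiegelDiff.gramPoly Q X₀ X₀)) ≠ 0) ∧
    (∀ T : Matrix (Fin n) (Fin n) ℝ, T.PosDef →
      LinearMap.det (SiegelDiff.bullet B (SiegelDiff.evalBlocks Q T T T)) ≠ 0) := by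
  refine ⟨?_, fun T hT =>
    SiegelDiff.det_bullet_evalBlocks_ne_zero hl hirr hpoly hB hBρ hQ0 hQ hT⟩
  obtain ⟨P, hP⟩ := SiegelDiff.exists_isometry hl
  -- Orthonormal columns give X₀ᵗX₀ = 1, hence full rank, and reduce the first claim to the case T =
  -- 1 of the second.
  set X₀ : Matrix (Fin l) (Fin n) ℝ := P * Matrix.fromRows 1 0
  have hX : X₀ᵀ * X₀ = 1 := by
    refine (SiegelDiff.transpose_mul_mul_of_isometry hP _ _).trans ?_
    rw [Matrix.transpose_fromRows, Matrix.fromCols_mul_fromRows]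
    simp
  refine ⟨X₀, ?_, ?_⟩
  · rw [← Matrix.rank_transpose_mul_self, hX, Matrix.rank_one, Fintype.card_fin]
  · rw [SiegelDiff.gramPoly, hX]
    exact SiegelDiff.det_bullet_evalBlocks_ne_zero hl hirr hpoly hB hBρ hQ0 hQ Matrix.PosDef.one
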